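/- Conventions. A real is a function $Z:\mathbb N\to\mathbb N$; a string is a finite sequence of natural numbers, identified with its code under a fixed computable injective coding in which proper initial segments have smaller codes; $Z\restriction n$ (resp. $\sigma\restriction n$) denotes the initial segment of length $n$ of $Z$ (resp. of $\sigma$, with $\sigma\restriction n=\sigma$ if $n\ge|\sigma|$). Fix a standard enumeration of oracle machines, with a step count. For a real $Z$, $\{e\}^Z(n){\downarrow}$ means that the $e$-th machine with oracle $Z$ halts on input $n$; for a string $\sigma$, $\{e\}^\sigma(n){\downarrow}$ means that the $e$-th machine with oracle $\sigma$ halts on input $n$ in fewer than $|\sigma|$ steps, querying only positions below $|\sigma|$. The jump of $Z$ is $Z'=\{e:\{e\}^Z(e){\downarrow}\}$, $Z^{(0)}=Z$, $Z^{(n+1)}=(Z^{(n)})'$, and $Z^{(\omega)}=\bigoplus_n Z^{(n)}$ is the real with $Z^{(\omega)}(\langle n,y\rangle)=Z^{(n)}(y)$ (sets being identified with their characteristic functions). The $\omega$-Jump Tree. For a string $\sigma$ let $t_{-1}=1$ and $t_n=\max\{t_{n-1}+1,\ \mu t\,(\{n\}^{\sigma\restriction t}(n){\downarrow})\}$, where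 $t_n=t_{n-1}+1$ if there is no such $t$. Let $J(\sigma)=\langle\sigma\restriction t_0,\dots,\sigma\restriction t_{k-1}\rangle$, where $k$ is least with $t_k>|\sigma|$, and $J^\omega(\sigma)=\langle J(\sigma)(0),J^2(\sigma)(0),\dots,J^{n-1}(\sigma)(0)\rangle$, where $n$ is least with $J^n(\sigma)=\emptyset$. For a tree $T$ put $\mathcal{JT}^\omega(T)=\{J^\omega(\sigma):\sigma\in T\}$. The Kleene–Brouwer order on strings is: $\sigma\le_{\mathrm{KB}}\tau$ iff $\sigma$ extends $\tau$ or, for some $i$ below both lengths, $\sigma\restriction i=\tau\restriction i$ and $\sigma(i)<\tau(i)$. The operator $\boldsymbol\varepsilon$. For a linear ordering $X$, the elements of $\boldsymbol\varepsilon_X$ are the formal sums $t=t_0+\dots+t_k$ in normal form: $t=0$, or $t_0\ge t_1\ge\dots\ge t_k>0$ where each $t_i$ is either a constant $\varepsilon_x$ with $x\in X$ or of the form $\omega^{s}$ with $s\in\boldsymbol\varepsilon_X$ in normal form and $s$ not a constant $\varepsilon_x$. Here, simultaneously, for $t=t_0+\dots+t_k$ and $s=s_0+\dots+s_l$ in normal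 form, $t\le s$ iff one of the following holds: $t=0$; $t=\varepsilon_x$ and some $\varepsilon_y$ with $y\ge_X x$ occurs in $s$; $t=\omega^{t'}$, $s_0=\varepsilon_y$ and $t'\le\varepsilon_y$; $t=\omega^{t'}$, $s_0=\omega^{s'}$ and $t'\le s'$; $k>0$ and $t_0<s_0$; $k>0$, $l>0$, $t_0=s_0$ and $t_1+\dots+t_k\le s_1+\dots+s_l$. Terms are coded by natural numbers in a standard computable way. Theorem. For every real $Z$ the linear ordering $X=\langle\mathcal{JT}^\omega(\{Z\restriction n:n\in\mathbb N\}),\le_{\mathrm{KB}}\rangle$ is $Z$-computable (its domain and its order relation are computable from $Z$) and has the following two properties: 1. for every infinite strictly descending sequence $f:\mathbb N\to X$, the jump $f'$ computes $Z^{(\omega)}$; 2. there is a $Z$-computable infinite strictly descending sequence in $\boldsymbol\varepsilon_X$. In particular, for every real $Z$ there is a $Z$-computable linear ordering $X$ with properties 1 and 2. -/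

import Mathlib

open scoped Computability

namespace EpsJump

/-! ### Strings, reals, trees, the Kleene–Brouwer order

A real is a function `ℕ → ℕ`, a string is a `List ℕ`.  A string `σ` is identified with the natural
number `Encodable.encode σ`, and `σ ↾ t` is `σ.take t`. -/

/-- `Z ↾ n`, the initial segment of length `n` of the real `Z`. -/
def initSeg (Z : ℕ → ℕ) (n : ℕ) : List ℕ := (List.range n).map Z

/-- The tree `T_Z = {Z ↾ n : n ∈ ℕ}`, whose only path is `Z`. -/
def realTree (Z : ℕ → ℕ) : Set (List ℕ) := Set.range (initSeg Z)

/-- The Kleene–Brouwer order: `σ ≤ τ` if `σ` extends `τ`, or `σ ↾ i = τ ↾ i` and `σ(i) < τ(i)` for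
some `i` below both lengths. -/
def KB (σ τ : List ℕ) : Prop :=
  τ <+: σ ∨ ∃ (i : ℕ) (h : i < σ.length) (h' : i < τ.length), σ.take i = τ.take i ∧ σ[i] < τ[i]

/-! ### Oracle programs and an abstract machine running them step by step -/

/-- Oracle programs. -/
inductive Prog : Type
  | zero | succ | left | right | oracle
  | pair (f g : Prog)
  | comp (f g : Prog)
  | prec (f g : Prog)
  | rfind (f : Prog)

/-- The enumeration of all oracle programs: `Prog.ofNat e` is the `e`-th one. -/
def Prog.ofNat : ℕ → Prog
  | 0 => zero
  | 1 => succ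
  | 2 => left
  | 3 => right
  | 4 => oracle
  | n + 5 =>
    have h : n / 4 < n + 5 := by omega
    have h₁ : (n / 4).unpair.1 < n + 5 := lt_of_le_of_lt (Nat.unpair_left_le _) h
    have h₂ : (n / 4).unpair.2 < n + 5 := lt_of_le_of_lt (Nat.unpair_right_le _) h
    match n % 4 with
    | 0 => pair (ofNat (n / 4).unpair.1) (ofNat (n / 4).unpair.2)
    | 1 => comp (ofNat (n / 4).unpair.1) (ofNat (n / 4).unpair.2)
    | 2 => prec (ofNat (n / 4).unpair.1) (ofNat (n / 4).unpair.2)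
    | _ => rfind (ofNat (n / 4))

/-- Stack frames of the machine: what remains to be done once the current subprogram returns. -/
inductive Frame : Type
  /-- then run `g` on `n` and pair the two results -/
  | pairLeft (g : Prog) (n : ℕ)
  /-- then return the pair of `u` and the result -/
  | pairRight (u : ℕ)
  /-- then run `f` on the result -/
  | comp (f : Prog)
  /-- the result is the value at `y` of a primitive recursion with parameter `a`, whose value at
  `m` is wanted -/
  | prec (g : Prog) (a y m : ℕ)
  /-- the result is the value of `f` at `(a, k)`, and the least zero of `f (a, ·)` is wanted -/
  | rfind (f : Prog) (a k : ℕ)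

/-- States of the machine: running a program on an input, or returning a value to the stack. -/
inductive State : Type
  | run (c : Prog) (n : ℕ) (K : List Frame)
  | ret (v : ℕ) (K : List Frame)

/-- One step of the machine with the (possibly partial) oracle `o`.  The machine has halted with
output `v` when it is in the state `ret v []`; a query which `o` does not answer makes it loop. -/
def step (o : ℕ → Option ℕ) : State → State
  | .run .zero _ K => .ret 0 K
  | .run .succ n K => .ret (n + 1) K
  | .run .left n K => .ret n.unpair.1 K
  | .run .right n K => .ret n.unpair.2 K
  | .run .oracle n K =>
    match o n with
    | some v => .ret v K
    | none => .run .oracle n K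
  | .run (.pair f g) n K => .run f n (.pairLeft g n :: K)
  | .run (.comp f g) n K => .run g n (.comp f :: K)
  | .run (.prec f g) n K => .run f n.unpair.1 (.prec g n.unpair.1 0 n.unpair.2 :: K)
  | .run (.rfind f) n K => .run f (Nat.pair n 0) (.rfind f n 0 :: K)
  | .ret v [] => .ret v []
  | .ret v (.pairLeft g n :: K) => .run g n (.pairRight v :: K)
  | .ret v (.pairRight u :: K) => .ret (Nat.pair u v) K
  | .ret v (.comp f :: K) => .run f v K
  | .ret v (.prec g a y m :: K) =>
    if y < m then .run g (Nat.pair a (Nat.pair y v)) (.prec g a (y + 1) m :: K) else .ret v K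
  | .ret v (.rfind f a k :: K) =>
    if v = 0 then .ret k K else .run f (Nat.pair a (k + 1)) (.rfind f a (k + 1) :: K)

/-- The `e`-th program on input `n` with oracle `o` has halted after `s` steps. -/
def HaltsIn (o : ℕ → Option ℕ) (e n s : ℕ) : Prop :=
  ∃ v : ℕ, (step o)^[s] (.run (Prog.ofNat e) n []) = .ret v []

/-- `{e}^Z(n)↓` for a real `Z`. -/
def HaltsReal (Z : ℕ → ℕ) (e n : ℕ) : Prop := ∃ s : ℕ, HaltsIn (fun i => some (Z i)) e n s

/-- `{e}^σ(n)↓` for a string `σ`: the computation halts in less than `|σ|` steps (and queries only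
positions below `|σ|`). -/
def HaltsString (σ : List ℕ) (e n : ℕ) : Prop := ∃ s < σ.length, HaltsIn (fun i => σ[i]?) e n s

/-! ### Turing reducibility and Turing jumps -/

/-- `f` is computable from `g`, for reals `f` and `g`. -/
def ComputableFrom (f g : ℕ → ℕ) : Prop := (f : ℕ →. ℕ) ≤ᵀ (g : ℕ →. ℕ)

open Classical in
/-- The characteristic function of a set of natural numbers. -/
noncomputable def charFn (S : Set ℕ) : ℕ → ℕ := fun n => if n ∈ S then 1 else 0

/-- The Turing jump `Z' = {e : {e}^Z(e)↓}`, as a characteristic function. -/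
noncomputable def turingJump (Z : ℕ → ℕ) : ℕ → ℕ := charFn {e | HaltsReal Z e e}

/-- `Z^(ω)`, the join of all the finite iterates `Z^(n)` of the jump. -/
noncomputable def omegaTuringJump (Z : ℕ → ℕ) : ℕ → ℕ :=
  fun m => turingJump^[m.unpair.1] Z m.unpair.2

/-! ### The Jump function, the `ω`-Jump function, the `ω`-Jump Tree -/

/-- The approximations to true stages: `stage σ (n + 1)` is
`t_n = max {t_{n-1} + 1, μ t ({n}^{σ ↾ t}(n)↓)}`, and `stage σ 0` is `t_{-1} = 1`.  If there is no
such `t`, the `sInf` below is `0` and `t_n = t_{n-1} + 1`. -/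
noncomputable def stage (σ : List ℕ) : ℕ → ℕ
  | 0 => 1
  | n + 1 => max (stage σ n + 1) (sInf {t | HaltsString (σ.take t) n n})

/-- The Jump function `J(σ) = ⟨σ ↾ t_0, …, σ ↾ t_{k-1}⟩`, where `k` is least with `t_k > |σ|`. -/
noncomputable def J (σ : List ℕ) : List ℕ :=
  (List.range (sInf {k | σ.length < stage σ (k + 1)})).map
    fun n => Encodable.encode (σ.take (stage σ (n + 1)))

/-- The `ω`-Jump function `J^ω(σ) = ⟨J(σ)(0), J²(σ)(0), …, J^{n-1}(σ)(0)⟩`, where `n` is least with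
`J^n(σ) = ∅`. -/
noncomputable def Jomega (σ : List ℕ) : List ℕ :=
  (List.range (sInf {n | J^[n] σ = []} - 1)).map fun i => (J^[i + 1] σ).headD 0

/-- The `ω`-Jump Tree of `T`. -/
def omegaJumpTree (T : Set (List ℕ)) : Set (List ℕ) := Jomega '' T

/-! ### Linear orderings on sets of natural numbers -/

/-- A linear ordering whose domain is a set of natural numbers. -/
structure LinOrd where
  dom : Set ℕ
  le : ℕ → ℕ → Prop
  mem_of_le : ∀ x y, le x y → x ∈ dom ∧ y ∈ dom
  refl : ∀ x ∈ dom, le x x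
  antisymm : ∀ x y, le x y → le y x → x = y
  trans : ∀ x y z, le x y → le y z → le x z
  total : ∀ x ∈ dom, ∀ y ∈ dom, le x y ∨ le y x

/-- `X` is a `Z`-computable linear ordering: its domain and its order relation are computable
from `Z`. -/
def LinOrd.IsComputableFrom (X : LinOrd) (Z : ℕ → ℕ) : Prop :=
  ComputableFrom (charFn X.dom) Z ∧
    ComputableFrom (charFn {p | X.le p.unpair.1 p.unpair.2}) Z

/-- `f` is an (infinite, strictly) descending sequence in `X`. -/
def LinOrd.IsDescending (X : LinOrd) (f : ℕ → ℕ) : Prop :=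
  (∀ n, f n ∈ X.dom) ∧ ∀ n, X.le (f (n + 1)) (f n) ∧ f (n + 1) ≠ f n

theorem KB_nil_right (σ : List ℕ) : KB σ [] := Or.inl List.nil_prefix

theorem KB_nil_cons (b : ℕ) (τ : List ℕ) : ¬ KB [] (b :: τ) := by
  simp [KB]

theorem KB_cons_cons (a b : ℕ) (σ τ : List ℕ) :
    KB (a :: σ) (b :: τ) ↔ a < b ∨ a = b ∧ KB σ τ := by
  unfold KB
  constructor
  · rintro (h | ⟨i, h, h', he, hl⟩)
    · rw [List.cons_prefix_cons] at h
      exact Or.inr ⟨h.1.symm, Or.inl h.2⟩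
    · cases i with
      | zero => exact Or.inl (by simpa using hl)
      | succ i =>
        simp only [List.take_succ_cons, List.cons.injEq] at he
        exact Or.inr ⟨he.1, Or.inr ⟨i, by simpa using h, by simpa using h', he.2,
          by simpa using hl⟩⟩
  · rintro (h | ⟨rfl, h | ⟨i, h, h', he, hl⟩⟩)
    · exact Or.inr ⟨0, by simp, by simp, by simp, by simpa using h⟩
    · exact Or.inl (List.cons_prefix_cons.2 ⟨rfl, h⟩)
    · exact Or.inr ⟨i + 1, by simpa using h, by simpa using h', by simpa using he,
        by simpa using hl⟩

theorem KB_refl (σ : List ℕ) : KB σ σ := Or.inl List.prefix_rfl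

theorem KB_antisymm : ∀ σ τ : List ℕ, KB σ τ → KB τ σ → σ = τ
  | [], [], _, _ => rfl
  | [], b :: τ, h, _ => absurd h (KB_nil_cons b τ)
  | a :: σ, [], _, h => absurd h (KB_nil_cons a σ)
  | a :: σ, b :: τ, h, h' => by
    rw [KB_cons_cons] at h h'
    have hab : a = b := by omega
    have h₁ : KB σ τ := by rcases h with h | h <;> [omega; exact h.2]
    have h₂ : KB τ σ := by rcases h' with h | h <;> [omega; exact h.2]
    rw [hab, KB_antisymm σ τ h₁ h₂]

theorem KB_trans : ∀ σ τ ρ : List ℕ, KB σ τ → KB τ ρ → KB σ ρ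
  | σ, _, [], _, _ => KB_nil_right σ
  | _, [], c :: ρ, _, h => absurd h (KB_nil_cons c ρ)
  | [], b :: τ, _ :: _, h, _ => absurd h (KB_nil_cons b τ)
  | a :: σ, b :: τ, c :: ρ, h, h' => by
    rw [KB_cons_cons] at h h' ⊢
    rcases h with h | ⟨h, k⟩ <;> rcases h' with h' | ⟨h', k'⟩
    · exact Or.inl (by omega)
    · exact Or.inl (by omega)
    · exact Or.inl (by omega)
    · exact Or.inr ⟨by omega, KB_trans σ τ ρ k k'⟩

theorem KB_total : ∀ σ τ : List ℕ, KB σ τ ∨ KB τ σ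
  | σ, [] => Or.inl (KB_nil_right σ)
  | [], τ => Or.inr (KB_nil_right τ)
  | a :: σ, b :: τ => by
    rw [KB_cons_cons, KB_cons_cons]
    have := KB_total σ τ
    rcases lt_trichotomy a b with h | h | h
    · exact Or.inl (Or.inl h)
    · rcases this with k | k
      · exact Or.inl (Or.inr ⟨h, k⟩)
      · exact Or.inr (Or.inr ⟨h.symm, k⟩)
    · exact Or.inr (Or.inl h)

/-- The linear ordering `⟨T, ≤_KB⟩`, for a set `T` of strings. -/
def kbOrder (T : Set (List ℕ)) : LinOrd where
  dom := Encodable.encode '' T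
  le x y := ∃ σ ∈ T, ∃ τ ∈ T, Encodable.encode σ = x ∧ Encodable.encode τ = y ∧ KB σ τ
  mem_of_le := by
    rintro _ _ ⟨σ, hσ, τ, hτ, rfl, rfl, -⟩
    exact ⟨⟨σ, hσ, rfl⟩, ⟨τ, hτ, rfl⟩⟩
  refl := by
    rintro _ ⟨σ, hσ, rfl⟩
    exact ⟨σ, hσ, σ, hσ, rfl, rfl, KB_refl σ⟩
  antisymm := by
    rintro _ _ ⟨σ, hσ, τ, hτ, rfl, rfl, h⟩ ⟨τ', _, σ', _, h₁, h₂, h'⟩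
    rw [Encodable.encode_injective h₁, Encodable.encode_injective h₂] at h'
    rw [KB_antisymm σ τ h h']
  trans := by
    rintro _ _ _ ⟨σ, hσ, τ, hτ, rfl, rfl, h⟩ ⟨τ', _, ρ, hρ, h₁, rfl, h'⟩
    rw [Encodable.encode_injective h₁] at h'
    exact ⟨σ, hσ, ρ, hρ, rfl, rfl, KB_trans σ τ ρ h h'⟩
  total := by
    rintro _ ⟨σ, hσ, rfl⟩ _ ⟨τ, hτ, rfl⟩
    rcases KB_total σ τ with h | h
    · exact Or.inl ⟨σ, hσ, τ, hτ, rfl, rfl, h⟩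
    · exact Or.inr ⟨τ, hτ, σ, hσ, rfl, rfl, h⟩

/-! ### The operator `X ↦ ε_X` -/

/-- Formal finite sums `t_0 + ⋯ + t_k` whose summands are constants `ε_x` or of the form `ω^s`.
The empty sum is `0`; `eps x r` is `ε_x + r` and `omega s r` is `ω^s + r`.  (So `+` is associative
and has `0` as neutral element by the way the terms are written.) -/
inductive Term : Type
  | zero
  | eps (x : ℕ) (r : Term)
  | omega (s r : Term)

namespace Term

/-- A numbering of the terms. -/
def code : Term → ℕ
  | zero => 0
  | eps x r => 2 * Nat.pair x r.code + 1
  | omega s r => 2 * Nat.pair s.code r.code + 2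

/-- The first summand `t_0` of `t_0 + ⋯ + t_k` (and `0` for `0`). -/
def head : Term → Term
  | zero => zero
  | eps x _ => eps x zero
  | omega s _ => omega s zero

/-- The remaining sum `t_1 + ⋯ + t_k`, which is `zero` exactly when `k = 0`. -/
def tail : Term → Term
  | zero => zero
  | eps _ r => r
  | omega _ r => r

/-- The constant `ε_y` occurs in the term. -/
def Occurs (y : ℕ) : Term → Prop
  | zero => False
  | eps x r => x = y ∨ Occurs y r
  | omega s r => Occurs y s ∨ Occurs y r

/-- The order of `ε_X`, for terms `t = t_0 + ⋯ + t_k` and `s = s_0 + ⋯ + s_l` in normal form. -/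
inductive Le (X : LinOrd) : Term → Term → Prop
  /-- `t = 0` -/
  | zero_le (s : Term) : Le X zero s
  /-- `t = ε_x` and `ε_y` occurs in `s` for some `y ≥ x` -/
  | eps_le {x y : ℕ} {s : Term} : X.le x y → Occurs y s → Le X (eps x zero) s
  /-- `t = ω^t'`, `s_0 = ε_y` and `t' ≤ ε_y` -/
  | omega_le_eps {t' : Term} {y : ℕ} {r : Term} :
      Le X t' (eps y zero) → Le X (omega t' zero) (eps y r)
  /-- `t = ω^t'`, `s_0 = ω^s'` and `t' ≤ s'` -/
  | omega_le_omega {t' s' r : Term} : Le X t' s' → Le X (omega t' zero) (omega s' r)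
  /-- `k > 0` and `t_0 < s_0` -/
  | head_lt {t s : Term} : t.tail ≠ zero → Le X t.head s.head → t.head ≠ s.head → Le X t s
  /-- `k > 0`, `t_0 = s_0`, `l > 0` and `t_1 + ⋯ + t_k ≤ s_1 + ⋯ + s_l` -/
  | tail_le {t s : Term} :
      t.tail ≠ zero → t.head = s.head → s.tail ≠ zero → Le X t.tail s.tail → Le X t s

/-- `t` is an element of `ε_X`: its constants `ε_x` have `x ∈ X`, and it is in normal form, that is
`t_0 ≥ t_1 ≥ ⋯ ≥ t_k`, and each `t_i = ω^s` has `s` in normal form and not a constant `ε_x`. -/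
def Mem (X : LinOrd) : Term → Prop
  | zero => True
  | eps x r => x ∈ X.dom ∧ Mem X r ∧ Le X r.head (eps x zero)
  | omega s r => Mem X s ∧ (∀ x, s ≠ eps x zero) ∧ Mem X r ∧ Le X r.head (omega s zero)

/-- `a` is an (infinite, strictly) descending sequence in `ε_X`. -/
def IsDescending (X : LinOrd) (a : ℕ → Term) : Prop :=
  (∀ n, Mem X (a n)) ∧ ∀ n, Le X (a (n + 1)) (a n) ∧ a (n + 1) ≠ a n

end Term

end EpsJump

/-! Write `J(σ) = ⟨σ ↾ t_0, …⟩`; here `t_n` is `stage σ (n + 1)`. Its entry `n` is long enough to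
witness `{n}^σ(n)↓` whenever that holds, so `J` is a finite approximation of the jump. Three facts
are used throughout: the last stage below `J(σ)` is `|σ|` itself, so `σ` is the last entry of `J(σ)`
(`getLast_J`); initial segments of `J(σ)` are the `J` of initial segments of `σ` (`take_J`); and for
`σ ⊆ τ` the two Jumps agree below the first program that converges anew (`take_J_eq`).

Computability: the code of `J^ω(σ)` bounds `|σ|` up to one, so `x ∈ X` is decided by finitely many
initial segments of `Z`.

Property 1: along a KB-descending sequence each entry is eventually defined and constant, so `f'`
computes the limit `Y` of the strings `J^ω(σ_i)`. Decoding last entries repeatedly recovers from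
`Y(m + j)` an initial segment of `J^m(σ_i)` of length above `j`, hence the limits `L_m` of the
`J^m(σ_i)`, uniformly in `m`. Now `L_0 = Z`, and `L_{m+1}(e)` codes an initial segment of `L_m` that
decides `{e}^{L_m}(e)↓`. Thus `L_m` computes `Z^(m)` by programs uniform in `m`
(`computableFrom_omegaTuringJump`).

Property 2: put `n = |J(σ)|` and let `descent pre σ` be the sum of the `ω^{K_i}` over the `i < n`
with `{i}^σ(i)↑`, followed by `ω^{K_n} + ω^{K_n}`. Here `K_0 = ε_pre + ε_pre`, and for `i > 0` the
exponent `K_i` is the term of `J(σ) ↾ i` with `J(σ)(0)` appended to `pre`. By induction the `K_i`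
strictly decrease: the constants of `K_i`, `i > 0`, properly extend `pre`, and the `J(σ) ↾ i` grow.
When `σ` is extended, either some program below `n` converges anew and a summand is lost, or a copy
of the final `ω^{K_n}` is replaced by smaller powers; what follows has smaller exponents, so the
term decreases (`descent_lt`). Apply this to the nonempty `Z ↾ n` with `pre` empty. -/

namespace EpsJump

/-! ### Primitive recursive functions, for `fun_prop` -/

attribute [fun_prop] Primrec
attribute [fun_prop] Primrec.id Primrec.const Primrec.fst Primrec.snd

section PrimrecRules

variable {α β γ σ : Type*} [Primcodable α] [Primcodable β] [Primcodable γ] [Primcodable σ]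

@[fun_prop] theorem primrec_comp {f : β → σ} {g : α → β} (hf : Primrec f) (hg : Primrec g) :
    Primrec fun a => f (g a) := hf.comp hg

@[fun_prop] theorem primrec_mk {f : α → β} {g : α → γ} (hf : Primrec f) (hg : Primrec g) :
    Primrec fun a => (f a, g a) := hf.pair hg

@[fun_prop] theorem primrec_add {f g : α → ℕ} (hf : Primrec f) (hg : Primrec g) :
    Primrec fun a => f a + g a := Primrec.nat_add.comp hf hg

@[fun_prop] theorem primrec_sub {f g : α → ℕ} (hf : Primrec f) (hg : Primrec g) :
    Primrec fun a => f a - g a := Primrec.nat_sub.comp hf hg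

@[fun_prop] theorem primrec_mul {f g : α → ℕ} (hf : Primrec f) (hg : Primrec g) :
    Primrec fun a => f a * g a := Primrec.nat_mul.comp hf hg

@[fun_prop] theorem primrec_div {f g : α → ℕ} (hf : Primrec f) (hg : Primrec g) :
    Primrec fun a => f a / g a := Primrec.nat_div.comp hf hg

@[fun_prop] theorem primrec_mod {f g : α → ℕ} (hf : Primrec f) (hg : Primrec g) :
    Primrec fun a => f a % g a := Primrec.nat_mod.comp hf hg

@[fun_prop] theorem primrec_max {f g : α → ℕ} (hf : Primrec f) (hg : Primrec g) :
    Primrec fun a => max (f a) (g a) := Primrec.nat_max.comp hf hg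

@[fun_prop] theorem primrec_natPair {f g : α → ℕ} (hf : Primrec f) (hg : Primrec g) :
    Primrec fun a => Nat.pair (f a) (g a) := Primrec₂.natPair.comp hf hg

@[fun_prop] theorem primrec_unpair {f : α → ℕ} (hf : Primrec f) :
    Primrec fun a => (f a).unpair := Primrec.unpair.comp hf

@[fun_prop] theorem primrec_encode {f : α → β} (hf : Primrec f) :
    Primrec fun a => Encodable.encode (f a) := Primrec.encode.comp hf

@[fun_prop] theorem primrec_ofNat {δ : Type*} [Denumerable δ] {f : α → ℕ} (hf : Primrec f) :
    Primrec fun a => Denumerable.ofNat δ (f a) := (Primrec.ofNat δ).comp hf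

@[fun_prop] theorem primrec_length {f : α → List β} (hf : Primrec f) :
    Primrec fun a => (f a).length := Primrec.list_length.comp hf

@[fun_prop] theorem primrec_tail {f : α → List β} (hf : Primrec f) :
    Primrec fun a => (f a).tail := Primrec.list_tail.comp hf

@[fun_prop] theorem primrec_range {f : α → ℕ} (hf : Primrec f) :
    Primrec fun a => List.range (f a) := Primrec.list_range.comp hf

@[fun_prop] theorem primrec_getD {d : β} {f : α → List β} {g : α → ℕ} (hf : Primrec f)
    (hg : Primrec g) : Primrec fun a => (f a).getD (g a) d := (Primrec.list_getD d).comp hf hg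

@[fun_prop] theorem primrec_headD {d : β} {f : α → List β} (hf : Primrec f) :
    Primrec fun a => (f a).headD d :=
  ((Primrec.list_getD d).comp hf (Primrec.const 0)).of_eq fun a => by cases f a <;> rfl

@[fun_prop] theorem primrec_cons {f : α → β} {g : α → List β} (hf : Primrec f)
    (hg : Primrec g) : Primrec fun a => f a :: g a := Primrec.list_cons.comp hf hg

@[fun_prop] theorem primrec_append {f g : α → List β} (hf : Primrec f)
    (hg : Primrec g) : Primrec fun a => f a ++ g a := Primrec.list_append.comp hf hg

@[fun_prop] theorem primrec_take {f : α → ℕ} {g : α → List β} (hf : Primrec f)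
    (hg : Primrec g) : Primrec fun a => (g a).take (f a) := Primrec.list_take.comp hf hg

@[fun_prop] theorem primrec_map {f : α → List β} {g : α → β → γ} (hf : Primrec f)
    (hg : Primrec fun p : α × β => g p.1 p.2) : Primrec fun a => (f a).map (g a) :=
  Primrec.list_map hf hg

@[fun_prop] theorem primrec_findIdx {f : α → List β} {p : α → β → Bool} (hf : Primrec f)
    (hp : Primrec fun q : α × β => p q.1 q.2) : Primrec fun a => (f a).findIdx (p a) :=
  Primrec.list_findIdx hf hp

@[fun_prop] theorem primrec_ite_eq [DecidableEq β] {c d : α → β} {f g : α → σ}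
    (hc : Primrec c) (hd : Primrec d) (hf : Primrec f) (hg : Primrec g) :
    Primrec fun a => if c a = d a then f a else g a := Primrec.ite (Primrec.eq.comp hc hd) hf hg

@[fun_prop] theorem primrec_ite_lt {c d : α → ℕ} {f g : α → σ}
    (hc : Primrec c) (hd : Primrec d) (hf : Primrec f) (hg : Primrec g) :
    Primrec fun a => if c a < d a then f a else g a :=
  Primrec.ite (Primrec.nat_lt.comp hc hd) hf hg

@[fun_prop] theorem primrec_decide_lt {c d : α → ℕ} (hc : Primrec c) (hd : Primrec d) :
    Primrec fun a => decide (c a < d a) := (Primrec.nat_lt.comp hc hd).decide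

@[fun_prop] theorem primrec_decide_eq [DecidableEq β] {c d : α → β} (hc : Primrec c)
    (hd : Primrec d) : Primrec fun a => decide (c a = d a) := (Primrec.eq.comp hc hd).decide

@[fun_prop] theorem primrec_and {f g : α → Bool} (hf : Primrec f) (hg : Primrec g) :
    Primrec fun a => (f a && g a) := Primrec.and.comp hf hg

@[fun_prop] theorem primrec_or {f g : α → Bool} (hf : Primrec f) (hg : Primrec g) :
    Primrec fun a => (f a || g a) := Primrec.or.comp hf hg

@[fun_prop] theorem primrec_not {f : α → Bool} (hf : Primrec f) :
    Primrec fun a => !(f a) := Primrec.not.comp hf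

@[fun_prop] theorem primrec_iterate {f : α → ℕ} {g : α → β} {h : α → β → β} (hf : Primrec f)
    (hg : Primrec g) (hh : Primrec fun p : α × β => h p.1 p.2) :
    Primrec fun a => (h a)^[f a] (g a) := Primrec.nat_iterate hf hg hh

theorem primrec_natRec {f : α → ℕ} {g : α → β} {h : α → ℕ → β → β} (hf : Primrec f)
    (hg : Primrec g) (hh : Primrec fun p : α × ℕ × β => h p.1 p.2.1 p.2.2) :
    Primrec fun a => (Nat.rec (g a) (fun n b => h a n b) (f a) : β) :=
  Primrec.nat_rec' hf hg (h := fun a p => h a p.1 p.2) hh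

end PrimrecRules

/-! ### The machine with a string as oracle is primitive recursive -/

/-- A numbering of the stack frames. -/
def Frame.ofNat (x : ℕ) : Frame :=
  match x % 5 with
  | 0 => .pairLeft (Prog.ofNat (x / 5).unpair.1) (x / 5).unpair.2
  | 1 => .pairRight (x / 5)
  | 2 => .comp (Prog.ofNat (x / 5))
  | 3 => .prec (Prog.ofNat (x / 5).unpair.1) (x / 5).unpair.2.unpair.1
      (x / 5).unpair.2.unpair.2.unpair.1 (x / 5).unpair.2.unpair.2.unpair.2
  | _ => .rfind (Prog.ofNat (x / 5).unpair.1) (x / 5).unpair.2.unpair.1 (x / 5).unpair.2.unpair.2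

/-- The state coded by a triple: `(0, v, K)` returns `v`, and `(e + 1, n, K)` runs the `e`-th
program on `n`. -/
def State.ofCode : ℕ × ℕ × List ℕ → State
  | (0, v, K) => .ret v (K.map Frame.ofNat)
  | (e + 1, n, K) => .run (Prog.ofNat e) n (K.map Frame.ofNat)

/-- The step on codes from a state which returns `v` to the frame `5 * y + r` on top of `K`. -/
def retCode (v r y : ℕ) (K : List ℕ) : ℕ × ℕ × List ℕ :=
  if r = 0 then (y.unpair.1 + 1, y.unpair.2, (5 * v + 1) :: K)
  else if r = 1 then (0, Nat.pair y v, K)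
  else if r = 2 then (y + 1, v, K)
  else if r = 3 then
    if y.unpair.2.unpair.2.unpair.1 < y.unpair.2.unpair.2.unpair.2 then
      (y.unpair.1 + 1, Nat.pair y.unpair.2.unpair.1 (Nat.pair y.unpair.2.unpair.2.unpair.1 v),
        (5 * Nat.pair y.unpair.1 (Nat.pair y.unpair.2.unpair.1
          (Nat.pair (y.unpair.2.unpair.2.unpair.1 + 1) y.unpair.2.unpair.2.unpair.2)) + 3) :: K)
    else (0, v, K)
  else if v = 0 then (0, y.unpair.2.unpair.2, K)
  else (y.unpair.1 + 1, Nat.pair y.unpair.2.unpair.1 (y.unpair.2.unpair.2 + 1),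
    (5 * Nat.pair y.unpair.1 (Nat.pair y.unpair.2.unpair.1 (y.unpair.2.unpair.2 + 1)) + 4) :: K)

/-- The step on codes from a state which runs the compound program `4 * x + r + 5`. -/
def runCode (n r x : ℕ) (K : List ℕ) : ℕ × ℕ × List ℕ :=
  if r = 0 then (x.unpair.1 + 1, n, (5 * Nat.pair x.unpair.2 n) :: K)
  else if r = 1 then (x.unpair.2 + 1, n, (5 * x.unpair.1 + 2) :: K)
  else if r = 2 then (x.unpair.1 + 1, n.unpair.1,
    (5 * Nat.pair x.unpair.2 (Nat.pair n.unpair.1 (Nat.pair 0 n.unpair.2)) + 3) :: K)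
  else (x + 1, Nat.pair n 0, (5 * Nat.pair x (Nat.pair n 0) + 4) :: K)

/-- The step on codes, with the string `σ` as oracle. -/
def stepCode (σ : List ℕ) (s : ℕ × ℕ × List ℕ) : ℕ × ℕ × List ℕ :=
  if s.1 = 0 then
    if s.2.2.length = 0 then s
    else retCode s.2.1 (s.2.2.headD 0 % 5) (s.2.2.headD 0 / 5) s.2.2.tail
  else if s.1 = 1 then (0, 0, s.2.2)
  else if s.1 = 2 then (0, s.2.1 + 1, s.2.2)
  else if s.1 = 3 then (0, s.2.1.unpair.1, s.2.2)
  else if s.1 = 4 then (0, s.2.1.unpair.2, s.2.2)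
  else if s.1 = 5 then
    if s.2.1 < σ.length then (0, σ.getD s.2.1 0, s.2.2) else s
  else runCode s.2.1 ((s.1 - 6) % 4) ((s.1 - 6) / 4) s.2.2

theorem primrec_retCode :
    Primrec fun p : ℕ × ℕ × ℕ × List ℕ => retCode p.1 p.2.1 p.2.2.1 p.2.2.2 := by
  unfold retCode; fun_prop

theorem primrec_runCode :
    Primrec fun p : ℕ × ℕ × ℕ × List ℕ => runCode p.1 p.2.1 p.2.2.1 p.2.2.2 := by
  unfold runCode; fun_prop

theorem primrec_stepCode :
    Primrec fun p : List ℕ × ℕ × ℕ × List ℕ => stepCode p.1 p.2 := by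
  have h₁ : Primrec fun p : List ℕ × ℕ × ℕ × List ℕ =>
      retCode p.2.2.1 (p.2.2.2.headD 0 % 5) (p.2.2.2.headD 0 / 5) p.2.2.2.tail :=
    primrec_retCode.comp (f := fun p : ℕ × ℕ × ℕ × List ℕ => retCode p.1 p.2.1 p.2.2.1 p.2.2.2)
      (g := fun p : List ℕ × ℕ × ℕ × List ℕ =>
        (p.2.2.1, p.2.2.2.headD 0 % 5, p.2.2.2.headD 0 / 5, p.2.2.2.tail)) (by fun_prop)
  have h₂ : Primrec fun p : List ℕ × ℕ × ℕ × List ℕ =>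
      runCode p.2.2.1 ((p.2.1 - 6) % 4) ((p.2.1 - 6) / 4) p.2.2.2 :=
    primrec_runCode.comp (f := fun p : ℕ × ℕ × ℕ × List ℕ => runCode p.1 p.2.1 p.2.2.1 p.2.2.2)
      (g := fun p : List ℕ × ℕ × ℕ × List ℕ =>
        (p.2.2.1, (p.2.1 - 6) % 4, (p.2.1 - 6) / 4, p.2.2.2)) (by fun_prop)
  unfold stepCode
  fun_prop

theorem Prog.ofNat_add_five (n : ℕ) : Prog.ofNat (n + 5) =
    match n % 4 with
    | 0 => .pair (.ofNat (n / 4).unpair.1) (.ofNat (n / 4).unpair.2)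
    | 1 => .comp (.ofNat (n / 4).unpair.1) (.ofNat (n / 4).unpair.2)
    | 2 => .prec (.ofNat (n / 4).unpair.1) (.ofNat (n / 4).unpair.2)
    | _ => .rfind (.ofNat (n / 4)) := by
  rw [Prog.ofNat]

theorem Frame.ofNat_mul_add (r y : ℕ) (hr : r < 5) : Frame.ofNat (5 * y + r) =
    match r with
    | 0 => .pairLeft (Prog.ofNat y.unpair.1) y.unpair.2
    | 1 => .pairRight y
    | 2 => .comp (Prog.ofNat y)
    | 3 => .prec (Prog.ofNat y.unpair.1) y.unpair.2.unpair.1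
        y.unpair.2.unpair.2.unpair.1 y.unpair.2.unpair.2.unpair.2
    | _ => .rfind (Prog.ofNat y.unpair.1) y.unpair.2.unpair.1 y.unpair.2.unpair.2 := by
  have h₁ : (5 * y + r) % 5 = r := by omega
  have h₂ : (5 * y + r) / 5 = y := by omega
  rw [Frame.ofNat, h₁, h₂]
  interval_cases r <;> rfl

theorem ofCode_retCode (o : ℕ → Option ℕ) (v r y : ℕ) (K : List ℕ) (hr : r < 5) :
    State.ofCode (retCode v r y K) =
      step o (.ret v (Frame.ofNat (5 * y + r) :: K.map Frame.ofNat)) := by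
  rw [Frame.ofNat_mul_add r y hr]
  have h0 := fun y => Frame.ofNat_mul_add 0 y (by omega)
  have h1 := fun y => Frame.ofNat_mul_add 1 y (by omega)
  have h2 := fun y => Frame.ofNat_mul_add 2 y (by omega)
  have h3 := fun y => Frame.ofNat_mul_add 3 y (by omega)
  have h4 := fun y => Frame.ofNat_mul_add 4 y (by omega)
  interval_cases r <;> simp only [retCode, step] <;> norm_num
  · simp [State.ofCode, h1]
  · simp [State.ofCode]
  · simp [State.ofCode]
  · split_ifs <;> simp [State.ofCode, h3]
  · split_ifs <;> simp [State.ofCode, h4]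

theorem ofCode_runCode (o : ℕ → Option ℕ) (n m : ℕ) (K : List ℕ) :
    State.ofCode (runCode n (m % 4) (m / 4) K) =
      step o (.run (Prog.ofNat (m + 5)) n (K.map Frame.ofNat)) := by
  rw [Prog.ofNat_add_five]
  have h0 := fun y => Frame.ofNat_mul_add 0 y (by omega)
  have h1 := fun y => Frame.ofNat_mul_add 1 y (by omega)
  have h2 := fun y => Frame.ofNat_mul_add 2 y (by omega)
  have h3 := fun y => Frame.ofNat_mul_add 3 y (by omega)
  have h4 := fun y => Frame.ofNat_mul_add 4 y (by omega)
  have hm : m % 4 < 4 := Nat.mod_lt _ (by omega)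
  generalize m % 4 = r at hm ⊢
  simp only [add_zero] at h0
  interval_cases r <;> simp [runCode, step, State.ofCode, h0, h2, h3, h4]

theorem ofCode_stepCode (σ : List ℕ) : ∀ s : ℕ × ℕ × List ℕ,
    State.ofCode (stepCode σ s) = step (fun i => σ[i]?) (State.ofCode s)
  | (0, v, []) => by simp [stepCode, State.ofCode, step]
  | (0, v, x :: K) => by
    have := ofCode_retCode (fun i => σ[i]?) v (x % 5) (x / 5) K (Nat.mod_lt _ (by omega))
    rw [Nat.div_add_mod] at this
    simpa [stepCode, State.ofCode] using this
  | (1, n, K) => by simp [stepCode, State.ofCode, step, Prog.ofNat]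
  | (2, n, K) => by simp [stepCode, State.ofCode, step, Prog.ofNat]
  | (3, n, K) => by simp [stepCode, State.ofCode, step, Prog.ofNat]
  | (4, n, K) => by simp [stepCode, State.ofCode, step, Prog.ofNat]
  | (5, n, K) => by
    by_cases h : n < σ.length
    · simp [stepCode, State.ofCode, step, Prog.ofNat, h]
    · simp [stepCode, State.ofCode, step, Prog.ofNat, h]
  | (m + 6, n, K) => by
    simpa [stepCode, State.ofCode] using ofCode_runCode (fun i => σ[i]?) n m K

theorem ofCode_iterate_stepCode (σ : List ℕ) (k : ℕ) (s : ℕ × ℕ × List ℕ) :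
    State.ofCode ((stepCode σ)^[k] s) = (step fun i => σ[i]?)^[k] (State.ofCode s) := by
  induction k generalizing s with
  | zero => rfl
  | succ k ih => rw [Function.iterate_succ_apply, Function.iterate_succ_apply, ih, ofCode_stepCode]

/-! ### Halting computations: monotonicity and finite use. -/

theorem step_ret_nil (o : ℕ → Option ℕ) (v k : ℕ) :
    (step o)^[k] (.ret v []) = .ret v [] :=
  Function.iterate_fixed rfl k

theorem HaltsIn.mono {o : ℕ → Option ℕ} {e n s t : ℕ} (h : HaltsIn o e n s) (hst : s ≤ t) :
    HaltsIn o e n t := by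
  obtain ⟨v, hv⟩ := h
  obtain ⟨d, rfl⟩ := Nat.exists_eq_add_of_le' hst
  exact ⟨v, by rw [Function.iterate_add_apply, hv, step_ret_nil]⟩

/-- An unanswered query is a fixed point of `step`, so a halting run never meets one, and the larger
oracle takes the same steps. -/
theorem iterate_step_mono {o o' : ℕ → Option ℕ} (h : ∀ i v, o i = some v → o' i = some v)
    {v : ℕ} : ∀ (k : ℕ) (s : State), (step o)^[k] s = .ret v [] → (step o')^[k] s = .ret v []
  | 0, _, hs => hs
  | k + 1, s, hs => by
    by_cases hq : ∃ n K, s = .run .oracle n K ∧ o n = none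
    · obtain ⟨n, K, rfl, hn⟩ := hq
      rw [Function.iterate_fixed (by simp [step, hn])] at hs
      cases hs
    · have : step o' s = step o s := by
        unfold step
        split <;> try rfl
        rename_i n K
        cases hn : o n with
        | none => exact absurd ⟨n, K, rfl, hn⟩ hq
        | some w => rw [h n w hn]
      rw [Function.iterate_succ_apply] at hs ⊢
      rw [this]
      exact iterate_step_mono h k _ hs

theorem HaltsIn.mono_oracle {o o' : ℕ → Option ℕ} (h : ∀ i v, o i = some v → o' i = some v)
    {e n s : ℕ} : HaltsIn o e n s → HaltsIn o' e n s :=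
  fun ⟨v, hv⟩ => ⟨v, iterate_step_mono h s _ hv⟩

theorem HaltsString.mono {σ τ : List ℕ} (h : σ <+: τ) {e n : ℕ} :
    HaltsString σ e n → HaltsString τ e n := by
  rintro ⟨s, hs, hh⟩
  refine ⟨s, hs.trans_le h.length_le, hh.mono_oracle fun i v hv => ?_⟩
  obtain ⟨ρ, rfl⟩ := h
  exact List.getElem?_append_left (List.getElem?_eq_some_iff.1 hv).1 ▸ hv

theorem length_initSeg (Z : ℕ → ℕ) (n : ℕ) : (initSeg Z n).length = n := by simp [initSeg]

theorem getElem?_initSeg (Z : ℕ → ℕ) (n i : ℕ) :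
    (initSeg Z n)[i]? = if i < n then some (Z i) else none := by
  unfold initSeg
  split_ifs with h <;> simp [h]

theorem HaltsString.haltsReal {Z : ℕ → ℕ} {N e n : ℕ} (h : HaltsString (initSeg Z N) e n) :
    HaltsReal Z e n := by
  obtain ⟨s, -, hh⟩ := h
  refine ⟨s, hh.mono_oracle fun i v hv => ?_⟩
  rw [getElem?_initSeg] at hv
  split_ifs at hv
  exact hv

/-- The use principle: a run of `k` steps makes at most `k` queries, so every long enough initial
segment answers them all. -/
theorem exists_initSeg_iterate_step {Z : ℕ → ℕ} {v : ℕ} : ∀ (k : ℕ) (s : State),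
    (step fun i => some (Z i))^[k] s = .ret v [] →
      ∃ N, ∀ M ≥ N, (step fun i => (initSeg Z M)[i]?)^[k] s = .ret v []
  | 0, _, hs => ⟨0, fun _ _ => hs⟩
  | k + 1, s, hs => by
    rw [Function.iterate_succ_apply] at hs
    obtain ⟨N, hN⟩ := exists_initSeg_iterate_step k _ hs
    have : ∃ N', ∀ M ≥ N', step (fun i => (initSeg Z M)[i]?) s = step (fun i => some (Z i)) s := by
      by_cases hq : ∃ n K, s = .run .oracle n K
      · obtain ⟨n, K, rfl⟩ := hq
        exact ⟨n + 1, fun M hM => by simp [step, getElem?_initSeg, show n < M by omega]⟩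
      · refine ⟨0, fun M _ => ?_⟩
        unfold step
        split <;> try rfl
        rename_i n K
        exact absurd ⟨n, K, rfl⟩ hq
    obtain ⟨N', hN'⟩ := this
    refine ⟨max N N', fun M hM => ?_⟩
    rw [Function.iterate_succ_apply, hN' M (le_of_max_le_right hM)]
    exact hN M (le_of_max_le_left hM)

theorem haltsReal_iff {Z : ℕ → ℕ} {e n : ℕ} :
    HaltsReal Z e n ↔ ∃ N, HaltsString (initSeg Z N) e n := by
  refine ⟨?_, fun ⟨N, h⟩ => h.haltsReal⟩
  rintro ⟨s, v, hv⟩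
  obtain ⟨N, hN⟩ := exists_initSeg_iterate_step s _ hv
  exact ⟨max N (s + 1), s, by rw [length_initSeg]; omega, v, hN _ (le_max_left _ _)⟩

/-- The decision procedure for `{e}^σ(n)↓`. -/
def haltsB (σ : List ℕ) (e n : ℕ) : Bool :=
  -- Halted states are fixed by `step`, so it suffices to inspect the state after `|σ| - 1` steps,
  -- the largest count the strict bound allows.
  decide (0 < σ.length) && (decide (((stepCode σ)^[σ.length - 1] (e + 1, n, [])).1 = 0) &&
    decide (((stepCode σ)^[σ.length - 1] (e + 1, n, [])).2.2.length = 0))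

theorem haltsB_iff {σ : List ℕ} {e n : ℕ} : haltsB σ e n = true ↔ HaltsString σ e n := by
  have key : ∀ s : ℕ × ℕ × List ℕ,
      (s.1 = 0 ∧ s.2.2.length = 0) ↔ ∃ v, State.ofCode s = .ret v []
    | (0, v, K) => by simp [State.ofCode]
    | (e + 1, n, K) => by simp [State.ofCode]
  unfold haltsB
  rw [Bool.and_eq_true, Bool.and_eq_true, decide_eq_true_iff, decide_eq_true_iff,
    decide_eq_true_iff, key, ofCode_iterate_stepCode]
  constructor
  · rintro ⟨h, v, hv⟩
    exact ⟨σ.length - 1, by omega, v, by simpa [State.ofCode] using hv⟩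
  · rintro ⟨s, hs, hh⟩
    obtain ⟨v, hv⟩ := hh.mono (show s ≤ σ.length - 1 by omega)
    exact ⟨by omega, v, by simpa [State.ofCode] using hv⟩

theorem primrec_haltsB' : Primrec fun p : List ℕ × ℕ × ℕ => haltsB p.1 p.2.1 p.2.2 := by
  have h : Primrec fun p : List ℕ × ℕ × ℕ =>
      (stepCode p.1)^[p.1.length - 1] (p.2.1 + 1, p.2.2, []) :=
    primrec_iterate (by fun_prop) (by fun_prop)
      (primrec_stepCode.comp (f := fun p : List ℕ × ℕ × ℕ × List ℕ => stepCode p.1 p.2)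
        (g := fun p : (List ℕ × ℕ × ℕ) × ℕ × ℕ × List ℕ => (p.1.1, p.2)) (by fun_prop))
  unfold haltsB
  fun_prop

@[fun_prop] theorem primrec_haltsB {α : Type*} [Primcodable α] {f : α → List ℕ} {g h : α → ℕ}
    (hf : Primrec f) (hg : Primrec g) (hh : Primrec h) :
    Primrec fun a => haltsB (f a) (g a) (h a) :=
  primrec_haltsB'.comp (f := fun p : List ℕ × ℕ × ℕ => haltsB p.1 p.2.1 p.2.2)
    (g := fun a => (f a, g a, h a)) (by fun_prop)

/-! ### The Jump function -/

/-- The least stage at which `{n}^σ(n)` converges, and `0` if it does not. -/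
noncomputable def haltTime (σ : List ℕ) (n : ℕ) : ℕ := sInf {t | HaltsString (σ.take t) n n}

theorem stage_succ (σ : List ℕ) (n : ℕ) :
    stage σ (n + 1) = max (stage σ n + 1) (haltTime σ n) := rfl

theorem haltTime_spec {σ : List ℕ} {n : ℕ} (h : HaltsString σ n n) :
    HaltsString (σ.take (haltTime σ n)) n n :=
  Nat.sInf_mem (s := {t | HaltsString (σ.take t) n n}) ⟨σ.length, by simpa using h⟩

theorem haltTime_le_of_halts {σ : List ℕ} {n t : ℕ} (h : HaltsString (σ.take t) n n) :
    haltTime σ n ≤ t :=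
  Nat.sInf_le h

theorem haltTime_of_not_halts {σ : List ℕ} {n : ℕ} (h : ¬ HaltsString σ n n) :
    haltTime σ n = 0 := by
  have : {t | HaltsString (σ.take t) n n} = ∅ :=
    Set.eq_empty_of_forall_notMem fun t ht => h (HaltsString.mono (List.take_prefix t σ) ht)
  rw [haltTime, this, Nat.sInf_empty]

theorem haltTime_le_length (σ : List ℕ) (n : ℕ) : haltTime σ n ≤ σ.length := by
  by_cases h : HaltsString σ n n
  · exact haltTime_le_of_halts (by simpa using h)
  · simp [haltTime_of_not_halts h]

theorem take_eq_of_prefix {σ τ : List ℕ} (h : σ <+: τ) {t : ℕ} (ht : t ≤ σ.length) :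
    τ.take t = σ.take t := by
  obtain ⟨ρ, rfl⟩ := h
  rw [List.take_append_of_le_length ht]

theorem haltTime_eq_of_prefix {σ τ : List ℕ} (h : σ <+: τ) {n : ℕ}
    (hn : HaltsString τ n n → HaltsString σ n n) : haltTime τ n = haltTime σ n := by
  by_cases hσ : HaltsString σ n n
  · have h₁ : haltTime τ n ≤ haltTime σ n := haltTime_le_of_halts (by
      rw [take_eq_of_prefix h (haltTime_le_length σ n)]
      exact haltTime_spec hσ)
    refine le_antisymm h₁ (haltTime_le_of_halts ?_)
    rw [← take_eq_of_prefix h (h₁.trans (haltTime_le_length σ n))]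
    exact haltTime_spec (hσ.mono h)
  · rw [haltTime_of_not_halts hσ, haltTime_of_not_halts (mt hn hσ)]

theorem stage_lt_succ (σ : List ℕ) (n : ℕ) : stage σ n < stage σ (n + 1) := by
  rw [stage_succ]; omega

theorem stage_strictMono (σ : List ℕ) : StrictMono (stage σ) :=
  strictMono_nat_of_lt_succ (stage_lt_succ σ)

theorem succ_le_stage (σ : List ℕ) (n : ℕ) : n + 1 ≤ stage σ n := by
  induction n with
  | zero => rfl
  | succ n ih => have := stage_lt_succ σ n; omega

theorem stage_eq_of_prefix {σ τ : List ℕ} (h : σ <+: τ) {n : ℕ}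
    (hn : ∀ i < n, HaltsString τ i i → HaltsString σ i i) : stage τ n = stage σ n := by
  induction n with
  | zero => rfl
  | succ n ih =>
    rw [stage_succ, stage_succ, ih fun i hi => hn i (by omega),
      haltTime_eq_of_prefix h (hn n (by omega))]

theorem lt_length_J {σ : List ℕ} {k : ℕ} : k < (J σ).length ↔ stage σ (k + 1) ≤ σ.length := by
  have hne : {k | σ.length < stage σ (k + 1)}.Nonempty :=
    ⟨σ.length, by have := succ_le_stage σ (σ.length + 1); simp only [Set.mem_ofPred_eq]; omega⟩
  have hJ : (J σ).length = sInf {k | σ.length < stage σ (k + 1)} := by simp [J]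
  rw [hJ]
  constructor
  · intro hk
    have := Nat.notMem_of_lt_sInf hk
    simpa using this
  · intro hk
    by_contra hlt
    have h₁ : σ.length < stage σ (sInf {k | σ.length < stage σ (k + 1)} + 1) := Nat.sInf_mem hne
    have h₂ := (stage_strictMono σ).monotone
      (show sInf {k | σ.length < stage σ (k + 1)} + 1 ≤ k + 1 by omega)
    omega

theorem getElem_J {σ : List ℕ} {k : ℕ} (hk : k < (J σ).length) :
    (J σ)[k] = Encodable.encode (σ.take (stage σ (k + 1))) := by
  simp [J]

/-- The first stage beyond `|σ|` cannot be a halting time, since these are at most `|σ|`; it is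
therefore one more than the stage before it, which must equal `|σ|`. -/
theorem stage_length_J {σ : List ℕ} (hσ : σ ≠ []) : stage σ (J σ).length = σ.length := by
  have h₁ : ¬ stage σ ((J σ).length + 1) ≤ σ.length := by rw [← lt_length_J]; omega
  have h₂ := haltTime_le_length σ (J σ).length
  rw [stage_succ] at h₁
  have h₃ : stage σ (J σ).length ≤ σ.length := by
    rcases hk : (J σ).length with _ | k
    · exact List.length_pos_iff.2 hσ
    · exact lt_length_J.1 (by omega)
  omega

theorem length_J_lt {σ : List ℕ} (hσ : σ ≠ []) : (J σ).length < σ.length := by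
  have := succ_le_stage σ (J σ).length
  rw [stage_length_J hσ] at this
  omega

theorem J_eq_nil_iff {σ : List ℕ} : J σ = [] ↔ σ.length ≤ 1 := by
  constructor
  · intro h
    by_cases hσ : σ = []
    · simp [hσ]
    · have := stage_length_J hσ
      rw [h] at this
      exact this.ge
  · intro h
    rw [← List.length_eq_zero_iff]
    by_contra hne
    have h₁ := lt_length_J.1 (Nat.pos_of_ne_zero hne)
    have : 1 + 1 ≤ stage σ (0 + 1) := succ_le_stage σ 1
    omega

theorem ne_nil_of_J_ne_nil {σ : List ℕ} (h : J σ ≠ []) : σ ≠ [] := by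
  rintro rfl
  exact h (J_eq_nil_iff.2 (by simp))

/-- The first `n` entries depend only on the halting times of the programs below `n`, which do not
change if none of these converges anew. -/
theorem take_J_eq {σ τ : List ℕ} (h : σ <+: τ) {n : ℕ} (hn : n ≤ (J σ).length)
    (hh : ∀ i < n, HaltsString τ i i → HaltsString σ i i) :
    n ≤ (J τ).length ∧ (J τ).take n = (J σ).take n := by
  have hτ : n ≤ (J τ).length := by
    rcases n with _ | n
    · omega
    · have h₁ := lt_length_J.1 (show n < (J σ).length by omega)
      have h₂ := h.length_le
      have : n < (J τ).length := lt_length_J.2 (by rw [stage_eq_of_prefix h hh]; omega)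
      omega
  refine ⟨hτ, List.ext_getElem (by simp [hn, hτ]) fun i hi hi' => ?_⟩
  simp only [List.length_take, lt_inf_iff] at hi hi'
  rw [List.getElem_take, List.getElem_take, getElem_J, getElem_J,
    stage_eq_of_prefix h fun j hj => hh j (by omega),
    take_eq_of_prefix h (lt_length_J.1 hi'.2)]

/-- Every convergence of a program `i < n` is already visible in `σ ↾ t_i`, hence at length `stage σ
n`. So both strings have the same first stages, and the shorter string ends exactly at its stage
`n`. -/
theorem take_J (σ : List ℕ) {n : ℕ} (hn : n ≤ (J σ).length) :
    (J σ).take n = J (σ.take (stage σ n)) := by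
  by_cases hσ : σ = []
  · have : J σ = [] := J_eq_nil_iff.2 (by simp [hσ])
    rw [hσ, List.take_nil, ← hσ, this, List.take_nil]
  have hle : stage σ n ≤ σ.length := by
    rcases n with _ | n
    · exact List.length_pos_iff.2 hσ
    · exact lt_length_J.1 (by omega)
  have hlen : (σ.take (stage σ n)).length = stage σ n := by simp [hle]
  have hpre : σ.take (stage σ n) <+: σ := List.take_prefix _ _
  have hh : ∀ i < n, HaltsString σ i i → HaltsString (σ.take (stage σ n)) i i := by
    intro i hi h
    refine (haltTime_spec h).mono ?_
    have h₁ : haltTime σ i ≤ stage σ n := by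
      have := (stage_strictMono σ).monotone (show i + 1 ≤ n by omega)
      rw [stage_succ] at this
      omega
    exact List.take_prefix_take_left h₁
  have hs := stage_eq_of_prefix hpre hh
  have hlenJ : (J (σ.take (stage σ n))).length = n := by
    have hne : σ.take (stage σ n) ≠ [] := by
      intro h0
      have := succ_le_stage σ n
      rw [h0] at hlen
      simp at hlen
      omega
    exact (stage_strictMono _).injective (((stage_length_J hne).trans hlen).trans hs)
  rw [(take_J_eq hpre hlenJ.ge hh).2]
  exact List.take_of_length_le hlenJ.le

theorem encode_le_of_mem : ∀ {σ : List ℕ} {x : ℕ}, x ∈ σ → x ≤ Encodable.encode σ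
  | y :: σ, x, hx => by
    rw [Encodable.encode_list_cons]
    rcases List.mem_cons.1 hx with rfl | hx
    · exact (Nat.left_le_pair _ _).trans (Nat.le_succ _)
    · exact (encode_le_of_mem hx).trans ((Nat.right_le_pair _ _).trans (Nat.le_succ _))

theorem getLast_J {σ : List ℕ} (h : J σ ≠ []) : (J σ).getLast h = Encodable.encode σ := by
  rw [List.getLast_eq_getElem, getElem_J]
  have : (J σ).length - 1 + 1 = (J σ).length := by
    have := List.length_pos_iff.2 h; omega
  rw [this, stage_length_J (ne_nil_of_J_ne_nil h), List.take_length]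

/-! ### The `ω`-Jump function -/

theorem exists_iterate_J_eq_nil (σ : List ℕ) : ∃ n, J^[n] σ = [] := by
  induction hn : σ.length using Nat.strong_induction_on generalizing σ with
  | _ n ih =>
    by_cases hσ : σ = []
    · exact ⟨0, hσ⟩
    · obtain ⟨m, hm⟩ := ih _ (hn ▸ length_J_lt hσ) (J σ) rfl
      exact ⟨m + 1, hm⟩

theorem Jomega_of_nil {σ : List ℕ} (h : J σ = []) : Jomega σ = [] := by
  have : sInf {n | J^[n] σ = []} ≤ 1 := Nat.sInf_le h
  simp [Jomega, show sInf {n | J^[n] σ = []} - 1 = 0 by omega]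

theorem Jomega_of_ne_nil {σ : List ℕ} (h : J σ ≠ []) :
    Jomega σ = (J σ).headD 0 :: Jomega (J σ) := by
  have hne := exists_iterate_J_eq_nil (J σ)
  have hs : sInf {n | J^[n] σ = []} = sInf {n | J^[n] (J σ) = []} + 1 := by
    refine le_antisymm (Nat.sInf_le ?_) ?_
    · exact Nat.sInf_mem (s := {n | J^[n] (J σ) = []}) hne
    · have h₁ : J^[sInf {n | J^[n] σ = []}] σ = [] :=
        Nat.sInf_mem (s := {n | J^[n] σ = []}) (exists_iterate_J_eq_nil σ)
      rcases hk : sInf {n | J^[n] σ = []} with _ | k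
      · rw [hk] at h₁
        exact absurd h₁ (ne_nil_of_J_ne_nil h)
      · rw [hk] at h₁
        have : sInf {n | J^[n] (J σ) = []} ≤ k := Nat.sInf_le h₁
        omega
  -- Positivity makes the truncated subtraction in `Jomega` exact.
  have h0 : sInf {n | J^[n] (J σ) = []} ≠ 0 := by
    intro h0
    have := Nat.sInf_mem (s := {n | J^[n] (J σ) = []}) hne
    rw [h0] at this
    exact h this
  have h1 : sInf {n | J^[n] σ = []} - 1 = (sInf {n | J^[n] (J σ) = []} - 1) + 1 := by omega
  rw [Jomega, h1, List.range_succ_eq_map, List.map_cons, List.map_map]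
  rfl

theorem getElem?_Jomega {σ : List ℕ} : ∀ {s x : ℕ}, (Jomega σ)[s]? = some x →
    (J^[s + 1] σ).head? = some x := by
  intro s x hx
  induction s generalizing σ with
  | zero =>
    by_cases h : J σ = []
    · simp [Jomega_of_nil h] at hx
    · rw [Jomega_of_ne_nil h] at hx
      rw [Function.iterate_one, List.head?_eq_some_head h]
      simpa [List.headD_eq_head?_getD, List.head?_eq_some_head h] using hx
  | succ s ih =>
    by_cases h : J σ = []
    · simp [Jomega_of_nil h] at hx
    · rw [Jomega_of_ne_nil h] at hx
      exact ih (by simpa using hx)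

/-- The code of `σ` is an entry of `J(σ)`, so codes do not decrease from `σ` to `J(σ)`. The chain
ends at a one-entry Jump, whose only entry is then an entry of `J^ω(σ)`. -/
theorem encode_le_encode_Jomega {σ : List ℕ} (h : J σ ≠ []) :
    Encodable.encode σ ≤ Encodable.encode (Jomega σ) := by
  induction hn : σ.length using Nat.strong_induction_on generalizing σ with
  | _ n ih =>
    rw [Jomega_of_ne_nil h, Encodable.encode_list_cons]
    have hlast := getLast_J h
    by_cases h2 : J (J σ) = []
    · have hlen := J_eq_nil_iff.1 h2
      obtain ⟨x, hx⟩ : ∃ x, J σ = [x] :=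
        List.length_eq_one_iff.1 (le_antisymm hlen (List.length_pos_iff.2 h))
      simp only [hx, List.getLast_singleton] at hlast
      rw [hx, ← hlast]
      exact (Nat.left_le_pair _ _).trans (Nat.le_succ _)
    · have h₁ := ih _ (hn ▸ length_J_lt (ne_nil_of_J_ne_nil h)) h2 rfl
      have h₂ : Encodable.encode σ ≤ Encodable.encode (J σ) :=
        hlast ▸ encode_le_of_mem (List.getLast_mem h)
      exact (h₂.trans h₁).trans ((Nat.right_le_pair _ _).trans (Nat.le_succ _))

theorem length_le_encode : ∀ σ : List ℕ, σ.length ≤ Encodable.encode σ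
  | [] => Nat.zero_le _
  | x :: σ => by
    rw [Encodable.encode_list_cons, List.length_cons]
    exact Nat.succ_le_succ ((length_le_encode σ).trans (Nat.right_le_pair _ _))

theorem length_le_encode_Jomega (σ : List ℕ) :
    σ.length ≤ Encodable.encode (Jomega σ) + 1 := by
  by_cases h : J σ = []
  · have := J_eq_nil_iff.1 h; omega
  · have h₁ := encode_le_encode_Jomega h
    have h₂ := length_le_encode σ
    omega

/-! ### The Jump functions are primitive recursive -/

theorem findIdx_range {p : ℕ → Bool} {n m : ℕ} (hm : m < n) (hp : p m = true)
    (hlt : ∀ k < m, p k = false) : (List.range n).findIdx p = m := by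
  rw [List.findIdx_eq (by simpa using hm)]
  simpa [hp] using hlt

theorem haltTime_eq (σ : List ℕ) (n : ℕ) : haltTime σ n =
    if haltsB σ n n = true then
      (List.range (σ.length + 1)).findIdx fun t => haltsB (σ.take t) n n
    else 0 := by
  split_ifs with h
  · rw [haltsB_iff] at h
    symm
    refine findIdx_range (Nat.lt_succ_of_le (haltTime_le_length σ n))
      (haltsB_iff.2 (haltTime_spec h)) fun k hk => ?_
    rw [← Bool.not_eq_true, haltsB_iff]
    exact fun hh => absurd (haltTime_le_of_halts hh) (not_le.2 hk)
  · rw [haltsB_iff] at h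
    exact haltTime_of_not_halts h

theorem primrec_haltTime : Primrec fun p : List ℕ × ℕ => haltTime p.1 p.2 := by
  simp only [haltTime_eq]
  fun_prop

theorem primrec_stage : Primrec fun p : List ℕ × ℕ => stage p.1 p.2 := by
  have h : Primrec fun p : List ℕ × ℕ =>
      (Nat.rec 1 (fun n b => max (b + 1) (haltTime p.1 n)) p.2 : ℕ) := by
    refine primrec_natRec (by fun_prop) (by fun_prop) ?_
    have := primrec_haltTime.comp (f := fun p : List ℕ × ℕ => haltTime p.1 p.2)
      (g := fun p : (List ℕ × ℕ) × ℕ × ℕ => (p.1.1, p.2.1)) (by fun_prop)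
    fun_prop
  refine h.of_eq fun p => ?_
  obtain ⟨σ, n⟩ := p
  induction n with
  | zero => rfl
  | succ n ih =>
    simp only at ih ⊢
    rw [stage_succ, ← ih]

@[fun_prop] theorem primrec_stage' {α : Type*} [Primcodable α] {f : α → List ℕ} {g : α → ℕ}
    (hf : Primrec f) (hg : Primrec g) : Primrec fun a => stage (f a) (g a) :=
  primrec_stage.comp (f := fun p : List ℕ × ℕ => stage p.1 p.2) (hf.pair hg)

theorem length_J_eq (σ : List ℕ) : (J σ).length =
    (List.range (σ.length + 1)).findIdx fun k => decide (σ.length < stage σ (k + 1)) := by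
  have hle : (J σ).length < σ.length + 1 := by
    by_cases hσ : σ = []
    · simp [J_eq_nil_iff.2 (show σ.length ≤ 1 by simp [hσ])]
    · exact (length_J_lt hσ).trans (Nat.lt_succ_self _)
  symm
  refine findIdx_range hle ?_ fun k hk => ?_
  · rw [decide_eq_true_iff, ← not_le, ← lt_length_J]
    omega
  · rw [decide_eq_false_iff_not, not_lt, ← lt_length_J]
    exact hk

theorem primrec_J : Primrec J := by
  have h : Primrec fun σ : List ℕ =>
      (List.range ((List.range (σ.length + 1)).findIdx fun k =>
        decide (σ.length < stage σ (k + 1)))).map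
        fun n => Encodable.encode (σ.take (stage σ (n + 1))) := by fun_prop
  refine h.of_eq fun σ => ?_
  rw [← length_J_eq]
  refine List.ext_getElem (by simp) fun i _ hi => ?_
  rw [getElem_J hi]
  simp

@[fun_prop] theorem primrec_J' {α : Type*} [Primcodable α] {f : α → List ℕ}
    (hf : Primrec f) : Primrec fun a => J (f a) := primrec_J.comp hf

/-- Course-of-values recursion on the length, with the single recursive call at `J σ`. -/
theorem primrec_Jomega : Primrec Jomega := by
  refine Primrec.nat_omega_rec' Jomega (m := List.length)
    (l := fun σ => if (J σ).length = 0 then [] else [J σ])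
    (g := fun σ v => some (if (J σ).length = 0 then [] else (J σ).headD 0 :: v.headD []))
    Primrec.list_length (by fun_prop) ?_ ?_ ?_
  · exact Primrec.option_some.comp (f := some)
      (g := fun p : List ℕ × List (List ℕ) =>
        if (J p.1).length = 0 then [] else (J p.1).headD 0 :: p.2.headD []) (by fun_prop)
  · intro σ τ hτ
    split_ifs at hτ with h
    · simp at hτ
    · rw [List.mem_singleton] at hτ
      subst hτ
      exact length_J_lt (ne_nil_of_J_ne_nil fun h0 => h (by simp [h0]))
  · intro σ
    split_ifs with h
    · rw [List.length_eq_zero_iff] at h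
      rw [Jomega_of_nil h]
    · rw [Jomega_of_ne_nil fun h0 => h (by simp [h0])]
      rfl

@[fun_prop] theorem primrec_Jomega' {α : Type*} [Primcodable α] {f : α → List ℕ}
    (hf : Primrec f) : Primrec fun a => Jomega (f a) := primrec_Jomega.comp hf

/-! ### Sums of powers of `ω` in `ε_X` -/

namespace Term

theorem le_refl_of_mem {X : LinOrd} : ∀ {t : Term}, Mem X t → Le X t t
  | zero, _ => .zero_le _
  | eps x r, h => by
    by_cases hr : r = zero
    · subst hr
      exact .eps_le (X.refl x h.1) (Or.inl rfl)
    · exact .tail_le hr rfl hr (le_refl_of_mem h.2.1)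
  | omega s r, h => by
    by_cases hr : r = zero
    · subst hr
      exact .omega_le_omega (le_refl_of_mem h.1)
    · exact .tail_le hr rfl hr (le_refl_of_mem h.2.2.1)

/-- An `ε`-number is closed under sums and powers of `ω`; in this order only the first summand has
to be compared, by induction. -/
theorem le_eps_of_occurs_lt {X : LinOrd} {y : ℕ} : ∀ {t : Term},
    (∀ x, Occurs x t → X.le x y ∧ x ≠ y) → Le X t (eps y zero)
  | zero, _ => .zero_le _
  | eps x r, h => by
    have hx := h x (Or.inl rfl)
    have hle : Le X (eps x zero) (eps y zero) := .eps_le hx.1 (Or.inl rfl)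
    by_cases hr : r = zero
    · exact hr ▸ hle
    · exact .head_lt hr hle fun he => hx.2 (Term.eps.inj he).1
  | omega s r, h => by
    have hle : Le X (omega s zero) (eps y zero) :=
      .omega_le_eps (le_eps_of_occurs_lt fun x hx => h x (Or.inl hx))
    by_cases hr : r = zero
    · exact hr ▸ hle
    · exact .head_lt hr hle (by simp [head])

/-- The strict order of `ε_X`. -/
def Lt (X : LinOrd) (t s : Term) : Prop := Le X t s ∧ t ≠ s

theorem lt_of_exponent_lt {X : LinOrd} {u v r r' : Term} (h : Lt X u v) :
    Lt X (omega u r) (omega v r') := by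
  refine ⟨?_, fun he => h.2 (Term.omega.inj he).1⟩
  by_cases hr : r = zero
  · exact hr ▸ .omega_le_omega h.1
  · exact .head_lt hr (.omega_le_omega h.1) fun he => h.2 (Term.omega.inj he).1

theorem omega_lt_omega_tail {X : LinOrd} {u r r' : Term} (hr : r ≠ zero) (hr' : r' ≠ zero)
    (h : Lt X r r') : Lt X (omega u r) (omega u r') :=
  ⟨.tail_le hr rfl hr' h.1, fun he => h.2 (Term.omega.inj he).2⟩

/-- The sum of the `ω ^ K j` over the `j` with `i ≤ j < i + d` and `c j`, followed by
`ω ^ K (i + d) + ω ^ K (i + d)`. -/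
def expSum (c : ℕ → Bool) (K : ℕ → Term) : ℕ → ℕ → Term
  -- The doubled last power dominates a sum that has one `ω ^ K i` followed by smaller powers.
  | i, 0 => omega (K i) (omega (K i) zero)
  | i, d + 1 => if c i = true then omega (K i) (expSum c K (i + 1) d) else expSum c K (i + 1) d

theorem exists_expSum_eq (c : ℕ → Bool) (K : ℕ → Term) (i d : ℕ) :
    ∃ m r, i ≤ m ∧ m ≤ i + d ∧ r ≠ zero ∧ expSum c K i d = omega (K m) r := by
  induction d generalizing i with
  | zero => exact ⟨i, _, le_rfl, le_rfl, by simp, rfl⟩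
  | succ d ih =>
    obtain ⟨m, r, h₁, h₂, h₃, h₄⟩ := ih (i + 1)
    rw [expSum]
    split_ifs
    · exact ⟨i, _, le_rfl, by omega, by simp [h₄], rfl⟩
    · exact ⟨m, r, by omega, by omega, h₃, h₄⟩

theorem expSum_ne_zero (c : ℕ → Bool) (K : ℕ → Term) (i d : ℕ) : expSum c K i d ≠ zero := by
  obtain ⟨m, r, -, -, -, h⟩ := exists_expSum_eq c K i d
  simp [h]

theorem expSum_congr {c : ℕ → Bool} {K K' : ℕ → Term} {i d : ℕ}
    (h : ∀ m, i ≤ m → m ≤ i + d → K m = K' m) : expSum c K i d = expSum c K' i d := by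
  induction d generalizing i with
  | zero => simp [expSum, h i le_rfl le_rfl]
  | succ d ih =>
    rw [expSum, expSum, h i le_rfl (by omega), ih fun m h₁ h₂ => h m (by omega) (by omega)]

/-- The sums agree before `n`, the first place of difference. There the larger sum has `ω ^ K n`,
which the other lacks, or ends with two copies, of which the other has at most one; all later
exponents of the other are below `K n`. -/
theorem expSum_lt_expSum {X : LinOrd} {c c' : ℕ → Bool} {K K' : ℕ → Term} {n d d' : ℕ} :
    ∀ {i : ℕ}, i ≤ n → n ≤ i + d → n < i + d' → (∀ j, i ≤ j → j < n → c j = c' j) →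
    (∀ j, i ≤ j → j ≤ n → K j = K' j) → (n < i + d → c n = true ∧ c' n = false) →
    (∀ m, n < m → m ≤ i + d' → Lt X (K' m) (K' n)) →
    Lt X (expSum c' K' i d') (expSum c K i d) := by
  induction d' generalizing d with
  | zero => intro i h₁ _ h₂; omega
  | succ d' ih =>
    intro i hin hd hd' hc hK hn hlt
    rcases hin.eq_or_lt with rfl | hin
    · obtain ⟨m, r, h₁, h₂, -, h₄⟩ := exists_expSum_eq c' K' (i + 1) d'
      have hm := hlt m (by omega) (by omega)
      rw [← hK i le_rfl le_rfl] at hm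
      rw [expSum, ← hK i le_rfl le_rfl, h₄]
      rcases d with _ | d
      · rw [expSum]
        split_ifs
        · exact omega_lt_omega_tail (by simp) (by simp) (lt_of_exponent_lt hm)
        · exact lt_of_exponent_lt hm
      · obtain ⟨e₁, e₂⟩ := hn (by omega)
        rw [expSum, e₁, e₂]
        exact lt_of_exponent_lt hm
    · rcases d with _ | d
      · omega
      · have := ih (d := d) (i := i + 1) (by omega) (by omega) (by omega)
          (fun j h₁ h₂ => hc j (by omega) h₂) (fun j h₁ h₂ => hK j (by omega) h₂)
          (fun h => hn (by omega)) (fun m h₁ h₂ => hlt m h₁ (by omega))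
        rw [expSum, expSum, ← hc i le_rfl hin, ← hK i le_rfl hin.le]
        split_ifs
        · exact omega_lt_omega_tail (expSum_ne_zero _ _ _ _) (expSum_ne_zero _ _ _ _) this
        · exact this

theorem occurs_expSum {c : ℕ → Bool} {K : ℕ → Term} {y i d : ℕ}
    (h : Occurs y (expSum c K i d)) : ∃ m, i ≤ m ∧ m ≤ i + d ∧ Occurs y (K m) := by
  induction d generalizing i with
  | zero =>
    refine ⟨i, le_rfl, le_rfl, ?_⟩
    simpa [expSum, Occurs] using h
  | succ d ih =>
    rw [expSum] at h
    split_ifs at h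
    · rcases h with h | h
      · exact ⟨i, le_rfl, by omega, h⟩
      · obtain ⟨m, h₁, h₂, h₃⟩ := ih h
        exact ⟨m, by omega, by omega, h₃⟩
    · obtain ⟨m, h₁, h₂, h₃⟩ := ih h
      exact ⟨m, by omega, by omega, h₃⟩

theorem mem_expSum {X : LinOrd} {c : ℕ → Bool} {K : ℕ → Term} {i d : ℕ}
    (hmem : ∀ m ≤ i + d, Mem X (K m)) (heps : ∀ m ≤ i + d, ∀ x, K m ≠ eps x zero)
    (hle : ∀ m ≤ i + d, ∀ j < m, Lt X (K m) (K j)) : Mem X (expSum c K i d) := by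
  induction d generalizing i with
  | zero =>
    have h := hmem i le_rfl
    exact ⟨h, heps i le_rfl, ⟨h, heps i le_rfl, trivial, .zero_le _⟩,
      .omega_le_omega (le_refl_of_mem h)⟩
  | succ d ih =>
    have hr : Mem X (expSum c K (i + 1) d) :=
      ih (fun m hm => hmem m (by omega)) (fun m hm => heps m (by omega))
        (fun m hm => hle m (by omega))
    rw [expSum]
    split_ifs
    · refine ⟨hmem i (by omega), heps i (by omega), hr, ?_⟩
      obtain ⟨m, r, h₁, h₂, -, h₄⟩ := exists_expSum_eq c K (i + 1) d
      rw [h₄]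
      exact .omega_le_omega (hle m (by omega) i (by omega)).1
    · exact hr

/-- Building the sum from its right end turns the definition, whose starting index varies, into a
primitive recursion on `d`. -/
theorem code_expSum (c : ℕ → Bool) (K : ℕ → Term) (k : ℕ) {d : ℕ} (hd : d ≤ k) :
    (expSum c K (k - d) d).code =
      (Nat.rec (2 * Nat.pair (K k).code (2 * Nat.pair (K k).code 0 + 2) + 2)
        (fun d b => if c (k - (d + 1)) = true then
          2 * Nat.pair (K (k - (d + 1))).code b + 2 else b) d : ℕ) := by
  induction d with
  | zero => rfl
  | succ d ih =>
    have h : k - (d + 1) + 1 = k - d := by omega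
    rw [expSum, h]
    simp only [← ih (by omega)]
    split_ifs <;> rfl

end Term

/-! ### A descending sequence in `ε_X` -/

open Term

/-- The term assigned to a string `σ`, with constants which are extensions of `pre`. -/
noncomputable def descent (pre σ : List ℕ) : Term :=
  expSum (fun i => !haltsB σ i i)
    -- The constant is doubled because normal form forbids an exponent that is a single constant
    -- `ε_x`.
    (fun i => if i = 0 then eps (Encodable.encode pre) (eps (Encodable.encode pre) zero)
      -- The guard serves termination. It fails only for empty `σ`, where just the exponent at `0`
      -- is used.
      else if _ : (J σ).length < σ.length then
        descent (pre ++ [(J σ).headD 0]) ((J σ).take i) else zero)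
    0 (J σ).length
termination_by σ.length
decreasing_by simp only [List.length_take]; omega

/-- The exponents of `descent pre σ`, where `ρ = J σ`. -/
noncomputable def exponent (pre ρ : List ℕ) (i : ℕ) : Term :=
  if i = 0 then eps (Encodable.encode pre) (eps (Encodable.encode pre) zero)
  else descent (pre ++ [ρ.headD 0]) (ρ.take i)

theorem exponent_zero (pre ρ : List ℕ) : exponent pre ρ 0 =
    eps (Encodable.encode pre) (eps (Encodable.encode pre) zero) := rfl

theorem exponent_of_ne_zero (pre ρ : List ℕ) {i : ℕ} (hi : i ≠ 0) :
    exponent pre ρ i = descent (pre ++ [ρ.headD 0]) (ρ.take i) := if_neg hi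

theorem descent_eq (pre σ : List ℕ) : descent pre σ =
    expSum (fun i => !haltsB σ i i) (exponent pre (J σ)) 0 (J σ).length := by
  rw [descent]
  refine expSum_congr fun m _ hm => ?_
  by_cases hm0 : m = 0
  · simp [hm0, exponent]
  · have hσ : σ ≠ [] := by
      rintro rfl
      rw [J_eq_nil_iff.2 (by simp)] at hm
      simp at hm
      exact hm0 hm
    simp [hm0, exponent, length_J_lt hσ]

theorem exists_descent_eq (pre σ : List ℕ) : ∃ u r, r ≠ zero ∧ descent pre σ = omega u r := by
  obtain ⟨m, r, -, -, hr, h⟩ := exists_expSum_eq (fun i => !haltsB σ i i) (exponent pre (J σ)) 0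
    (J σ).length
  exact ⟨_, r, hr, by rw [descent_eq, h]⟩

theorem headD_take {ρ : List ℕ} {i : ℕ} (hi : i ≠ 0) : (ρ.take i).headD 0 = ρ.headD 0 := by
  obtain ⟨i, rfl⟩ := Nat.exists_eq_succ_of_ne_zero hi
  cases ρ <;> rfl

theorem exponent_congr {pre ρ ρ' : List ℕ} {n i : ℕ} (h : ρ'.take n = ρ.take n) (hi : i ≤ n) :
    exponent pre ρ i = exponent pre ρ' i := by
  by_cases hi0 : i = 0
  · simp [hi0, exponent_zero]
  · have h' : ρ'.take i = ρ.take i := by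
      have := congrArg (List.take i) h
      rwa [List.take_take, List.take_take, min_eq_left hi] at this
    rw [exponent_of_ne_zero _ _ hi0, exponent_of_ne_zero _ _ hi0, ← headD_take hi0, ← h',
      headD_take hi0]

/-- The strings `pre ⌢ J^ω(σ')` lie in `T`, for all nonempty initial segments `σ'` of `σ`. -/
def Admissible (T : Set (List ℕ)) (pre σ : List ℕ) : Prop :=
  ∀ σ', σ' ≠ [] → σ' <+: σ → pre ++ Jomega σ' ∈ T

/-- By `take_J`, with `σ'` cut at `stage σ ρ.length`. This carries statements about initial segments
of `J σ` back to initial segments of `σ`, as the recursion in `descent` requires. -/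
theorem exists_prefix_J_eq {σ ρ : List ℕ} (hρ : ρ ≠ []) (h : ρ <+: J σ) :
    ∃ σ', σ' ≠ [] ∧ σ' <+: σ ∧ J σ' = ρ ∧ Jomega σ' = (J σ).headD 0 :: Jomega ρ := by
  have hlen := h.length_le
  have htake : ρ = (J σ).take ρ.length := List.prefix_iff_eq_take.1 h
  have hJ : J (σ.take (stage σ ρ.length)) = ρ := by rw [← take_J σ hlen, ← htake]
  have hne : J (σ.take (stage σ ρ.length)) ≠ [] := by rw [hJ]; exact hρ
  refine ⟨_, ne_nil_of_J_ne_nil hne, List.take_prefix _ _, hJ, ?_⟩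
  rw [Jomega_of_ne_nil hne, hJ]
  congr 1
  have h0 : ρ.length ≠ 0 := fun h0 => hρ (List.length_eq_zero_iff.1 h0)
  rw [htake, headD_take h0]

theorem Admissible.take_J {T : Set (List ℕ)} {pre σ : List ℕ} (h : Admissible T pre σ) (i : ℕ) :
    Admissible T (pre ++ [(J σ).headD 0]) ((J σ).take i) := by
  intro ρ hρ hpre
  obtain ⟨σ', h₁, h₂, -, h₄⟩ := exists_prefix_J_eq hρ (hpre.trans (List.take_prefix _ _))
  have := h σ' h₁ h₂
  rw [h₄] at this
  simpa using this

theorem Admissible.pre_mem {T : Set (List ℕ)} {pre σ : List ℕ} (h : Admissible T pre σ)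
    (hσ : σ ≠ []) : pre ∈ T := by
  obtain ⟨a, τ, rfl⟩ := List.exists_cons_of_ne_nil hσ
  have := h [a] (by simp) ⟨τ, rfl⟩
  rwa [Jomega_of_nil (J_eq_nil_iff.2 (by simp)), List.append_nil] at this

theorem take_J_ne_nil {σ : List ℕ} {i : ℕ} (hi : i ≠ 0) (hle : i ≤ (J σ).length) :
    (J σ).take i ≠ [] := by
  rw [← List.length_pos_iff, List.length_take]
  omega

theorem length_take_J_lt {σ : List ℕ} (hσ : σ ≠ []) (i : ℕ) :
    ((J σ).take i).length < σ.length :=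
  (List.length_take_le' i (J σ)).trans_lt (length_J_lt hσ)

/-- The constant at exponent `0` comes from a string of length one, whose `J^ω` is empty; the others
come from the recursive calls through `exists_prefix_J_eq`. -/
theorem occurs_descent {pre σ : List ℕ} (hσ : σ ≠ []) {y : ℕ} (hy : Occurs y (descent pre σ)) :
    ∃ σ', σ' ≠ [] ∧ σ' <+: σ ∧ y = Encodable.encode (pre ++ Jomega σ') := by
  induction hn : σ.length using Nat.strong_induction_on generalizing pre σ with
  | _ n ih =>
    rw [descent_eq] at hy
    obtain ⟨m, -, hm, hy⟩ := occurs_expSum hy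
    rw [zero_add] at hm
    by_cases hm0 : m = 0
    · subst hm0
      have : y = Encodable.encode pre := by
        simpa [exponent_zero, Occurs, eq_comm] using hy
      obtain ⟨a, τ, rfl⟩ := List.exists_cons_of_ne_nil hσ
      exact ⟨[a], by simp, ⟨τ, rfl⟩,
        by rw [this, Jomega_of_nil (J_eq_nil_iff.2 (by simp)), List.append_nil]⟩
    · rw [exponent_of_ne_zero _ _ hm0] at hy
      obtain ⟨ρ, h₁, h₂, h₃⟩ :=
        ih _ (hn ▸ length_take_J_lt hσ m) (take_J_ne_nil hm0 hm) hy rfl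
      obtain ⟨σ', h₄, h₅, -, h₆⟩ := exists_prefix_J_eq h₁ (h₂.trans (List.take_prefix _ _))
      exact ⟨σ', h₄, h₅, by rw [h₃, h₆]; simp⟩

/-- All constants of the left side properly extend `pre` and are thus KB-below it, so its first
summand is already below `ε_pre`. -/
theorem descent_lt_exponent_zero {T : Set (List ℕ)} {pre σ : List ℕ} (hpre : pre ∈ T)
    {a : ℕ} (h : Admissible T (pre ++ [a]) σ) (hσ : σ ≠ []) (ρ : List ℕ) :
    Lt (kbOrder T) (descent (pre ++ [a]) σ) (exponent pre ρ 0) := by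
  have key : ∀ x, Occurs x (descent (pre ++ [a]) σ) →
      (kbOrder T).le x (Encodable.encode pre) ∧ x ≠ Encodable.encode pre := by
    intro x hx
    obtain ⟨σ', h₁, h₂, rfl⟩ := occurs_descent hσ hx
    refine ⟨⟨_, h σ' h₁ h₂, pre, hpre, rfl, rfl, Or.inl ?_⟩, fun he => ?_⟩
    · rw [List.append_assoc]
      exact List.prefix_append _ _
    · have := congrArg List.length (Encodable.encode_injective he)
      simp at this
  obtain ⟨u, r, hr, hu⟩ := exists_descent_eq (pre ++ [a]) σ
  rw [hu] at key ⊢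
  rw [exponent_zero]
  refine ⟨.head_lt hr (.omega_le_eps (le_eps_of_occurs_lt fun x hx => key x (Or.inl hx)))
    (by simp [head]), by simp⟩

/-- Induction on the length of `τ`: the inductive hypothesis makes the exponents of `τ` strictly
decreasing, and the two sums are then compared at their first difference. -/
theorem descent_lt {T : Set (List ℕ)} {pre σ τ : List ℕ} (hσ : σ ≠ []) (hpre : σ <+: τ)
    (hne : σ ≠ τ) (h : Admissible T pre τ) :
    Lt (kbOrder T) (descent pre τ) (descent pre σ) := by
  induction hN : τ.length using Nat.strong_induction_on generalizing pre σ τ with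
  | _ N ih =>
    have hlt : σ.length < τ.length :=
      lt_of_le_of_ne hpre.length_le fun he => hne (hpre.eq_of_length he)
    have hτ : τ ≠ [] := by rintro rfl; simp at hlt
    have hmono : ∀ n m, n < m → m ≤ (J τ).length →
        Lt (kbOrder T) (exponent pre (J τ) m) (exponent pre (J τ) n) := by
      intro n m hnm hm
      rw [exponent_of_ne_zero _ _ (show m ≠ 0 by omega)]
      by_cases hn : n = 0
      · subst hn
        exact descent_lt_exponent_zero (h.pre_mem hτ) (h.take_J m)
          (take_J_ne_nil (by omega) hm) _
      · rw [exponent_of_ne_zero _ _ hn]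
        refine ih _ (hN ▸ length_take_J_lt hτ m) (take_J_ne_nil hn (by omega))
          (List.take_prefix_take_left hnm.le) (fun he => ?_) (h.take_J m) rfl
        have := congrArg List.length he
        simp only [List.length_take] at this
        omega
    -- `n` is the least program below `|J σ|` that converges on `τ` but not on `σ`, or `|J σ|` if
    -- there is none.
    obtain ⟨n, hn, hagree, hnew⟩ : ∃ n ≤ (J σ).length,
        (∀ i < n, HaltsString τ i i → HaltsString σ i i) ∧
        (n < (J σ).length → HaltsString τ n n ∧ ¬ HaltsString σ n n) := by
      by_cases hex : ∃ n, n < (J σ).length ∧ HaltsString τ n n ∧ ¬ HaltsString σ n n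
      · classical
        refine ⟨Nat.find hex, (Nat.find_spec hex).1.le, fun i hi hi' => ?_,
          fun _ => (Nat.find_spec hex).2⟩
        by_contra hi''
        exact Nat.find_min hex hi ⟨hi.trans (Nat.find_spec hex).1, hi', hi''⟩
      · push Not at hex
        exact ⟨_, le_rfl, fun i hi hi' => hex i hi hi', fun h => absurd h (lt_irrefl _)⟩
    obtain ⟨hnτ, htake⟩ := take_J_eq hpre hn hagree
    -- Stage `n` is common to both strings and at most `|σ| < |τ|`, so the next stage of `τ` is
    -- still within `τ`.
    have hn' : n < (J τ).length := by
      rw [lt_length_J, stage_succ, stage_eq_of_prefix hpre hagree]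
      have h₁ := (stage_strictMono σ).monotone hn
      rw [stage_length_J hσ] at h₁
      have := haltTime_le_length τ n
      omega
    rw [descent_eq, descent_eq]
    refine expSum_lt_expSum (n := n) (Nat.zero_le _) (by omega) (by omega) ?_ ?_ ?_ ?_
    · intro j _ hj
      have : haltsB σ j j = haltsB τ j j := by
        rw [Bool.eq_iff_iff, haltsB_iff, haltsB_iff]
        exact ⟨HaltsString.mono hpre, hagree j hj⟩
      rw [this]
    · exact fun j _ hj => exponent_congr htake hj
    · intro hlt
      obtain ⟨h₁, h₂⟩ := hnew (by omega)
      rw [← haltsB_iff] at h₁ h₂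
      simp [h₁, h₂]
    · exact fun m h₁ h₂ => hmono n m h₁ (by omega)

theorem mem_descent {T : Set (List ℕ)} {pre σ : List ℕ} (hσ : σ ≠ [])
    (h : Admissible T pre σ) : Mem (kbOrder T) (descent pre σ) := by
  induction hN : σ.length using Nat.strong_induction_on generalizing pre σ with
  | _ N ih =>
    have hdom : Encodable.encode pre ∈ (kbOrder T).dom := ⟨pre, h.pre_mem hσ, rfl⟩
    rw [descent_eq]
    refine mem_expSum (fun m hm => ?_) (fun m _ x => ?_) (fun m hm j hj => ?_)
    · rw [zero_add] at hm
      by_cases hm0 : m = 0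
      · subst hm0
        exact ⟨hdom, ⟨hdom, trivial, .zero_le _⟩,
          .eps_le ((kbOrder T).refl _ hdom) (Or.inl rfl)⟩
      · rw [exponent_of_ne_zero _ _ hm0]
        exact ih _ (hN ▸ length_take_J_lt hσ m) (take_J_ne_nil hm0 hm) (h.take_J m) rfl
    · by_cases hm0 : m = 0
      · simp [hm0, exponent_zero]
      · obtain ⟨u, r, -, hu⟩ := exists_descent_eq (pre ++ [(J σ).headD 0]) ((J σ).take m)
        rw [exponent_of_ne_zero _ _ hm0, hu]
        simp
    · rw [zero_add] at hm
      have hm0 : m ≠ 0 := by omega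
      rw [exponent_of_ne_zero _ _ hm0]
      by_cases hj0 : j = 0
      · subst hj0
        exact descent_lt_exponent_zero (h.pre_mem hσ) (h.take_J m) (take_J_ne_nil hm0 hm) _
      · rw [exponent_of_ne_zero _ _ hj0]
        refine descent_lt (take_J_ne_nil hj0 (by omega))
          (List.take_prefix_take_left hj.le) (fun he => ?_) (h.take_J m)
        have := congrArg List.length he
        simp only [List.length_take] at this
        omega

/-! ### The descending sequence along the initial segments of `Z`. -/

theorem eq_initSeg_of_prefix {Z : ℕ → ℕ} {n : ℕ} {σ : List ℕ} (h : σ <+: initSeg Z n) :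
    σ = initSeg Z σ.length := by
  have h₁ := h.length_le
  rw [length_initSeg] at h₁
  rw [List.prefix_iff_eq_take.1 h]
  refine List.ext_getElem? fun i => ?_
  simp only [List.getElem?_take, getElem?_initSeg, List.length_take, length_initSeg]
  split_ifs <;> first | rfl | omega

theorem initSeg_prefix (Z : ℕ → ℕ) {n m : ℕ} (h : n ≤ m) : initSeg Z n <+: initSeg Z m := by
  rw [List.prefix_iff_eq_take]
  refine List.ext_getElem? fun i => ?_
  simp only [List.getElem?_take, getElem?_initSeg, length_initSeg]
  split_ifs <;> first | rfl | omega

theorem admissible_initSeg (Z : ℕ → ℕ) (n : ℕ) :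
    Admissible (omegaJumpTree (realTree Z)) [] (initSeg Z n) :=
  fun σ _ hσ => ⟨σ, ⟨σ.length, (eq_initSeg_of_prefix hσ).symm⟩, rfl⟩

theorem isDescending_descent (Z : ℕ → ℕ) :
    Term.IsDescending (kbOrder (omegaJumpTree (realTree Z)))
      fun n => descent [] (initSeg Z (n + 1)) := by
  have hne : ∀ n, initSeg Z (n + 1) ≠ [] := fun n h0 => by
    have := congrArg List.length h0
    simp [length_initSeg] at this
  refine ⟨fun n => mem_descent (hne n) (admissible_initSeg Z _), fun n =>
    descent_lt (hne n) (initSeg_prefix Z (by omega)) (fun he => ?_) (admissible_initSeg Z _)⟩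
  have := congrArg List.length he
  simp [length_initSeg] at this

theorem primrec_code_descent :
    Primrec fun p : List ℕ × List ℕ => (descent p.1 p.2).code := by
  -- The code of exponent `0` is put before the values of the recursive calls, so that entry `m` of
  -- the list is the code of exponent `m`.
  let base (q : (List ℕ × List ℕ) × List ℕ) : List ℕ :=
    (2 * Nat.pair (Encodable.encode q.1.1) (2 * Nat.pair (Encodable.encode q.1.1) 0 + 1) + 1) :: q.2
  let g (p : List ℕ × List ℕ) (v : List ℕ) : ℕ :=
    Nat.rec (2 * Nat.pair ((base (p, v)).getD (J p.2).length 0)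
        (2 * Nat.pair ((base (p, v)).getD (J p.2).length 0) 0 + 2) + 2)
      (fun d b => if (!haltsB p.2 ((J p.2).length - (d + 1)) ((J p.2).length - (d + 1))) = true then
        2 * Nat.pair ((base (p, v)).getD ((J p.2).length - (d + 1)) 0) b + 2 else b) (J p.2).length
  have hbase : Primrec base := by fun_prop
  have hg : Primrec fun q : (List ℕ × List ℕ) × List ℕ => g q.1 q.2 :=
    primrec_natRec (by fun_prop) (by fun_prop) (by fun_prop)
  refine Primrec.nat_omega_rec' (fun p : List ℕ × List ℕ => (descent p.1 p.2).code)
    (m := fun p => p.2.length)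
    (l := fun p => (List.range (J p.2).length).map
      fun i => (p.1 ++ [(J p.2).headD 0], (J p.2).take (i + 1)))
    (g := fun p v => some (g p v))
    (by fun_prop) (by fun_prop) (Primrec.option_some.comp hg) ?_ ?_
  · rintro ⟨pre, σ⟩ b hb
    simp only [List.mem_map, List.mem_range] at hb
    obtain ⟨i, hi, rfl⟩ := hb
    refine length_take_J_lt ?_ _
    rintro rfl
    rw [J_eq_nil_iff.2 (by simp)] at hi
    simp at hi
  · rintro ⟨pre, σ⟩
    have hK : ∀ m ≤ (J σ).length, (base ((pre, σ), ((List.range (J σ).length).map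
        fun i => (pre ++ [(J σ).headD 0], (J σ).take (i + 1))).map
          fun p => (descent p.1 p.2).code)).getD m 0 = (exponent pre (J σ) m).code := by
      rintro (_ | m) hm
      · rfl
      · rw [exponent_of_ne_zero _ _ (by omega)]
        simp [base, List.getD, List.getElem?_range (show m < (J σ).length by omega)]
    have h := code_expSum (fun i => !haltsB σ i i) (exponent pre (J σ)) (J σ).length le_rfl
    rw [Nat.sub_self, ← descent_eq] at h
    simp only [h, g, hK _ le_rfl, hK _ (Nat.sub_le _ _)]

/-! ### Relative computability -/

namespace ComputableFrom

variable {f g h : ℕ → ℕ}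

theorem iff_nat : ComputableFrom f g ↔
    Nat.RecursiveIn {fun n => Part.some (g n)} fun n => Part.some (f n) :=
  RecursiveIn.iff_nat

theorem of_primrec (hf : Primrec f) : ComputableFrom f g :=
  iff_nat.2 (Nat.Primrec.recursiveIn (Primrec.nat_iff.1 hf))

protected theorem refl (f : ℕ → ℕ) : ComputableFrom f f := TuringReducible.refl _

protected theorem comp (hf : ComputableFrom f h) (hg : ComputableFrom g h) :
    ComputableFrom (fun n => f (g n)) h :=
  iff_nat.2 (((iff_nat.1 hf).comp (iff_nat.1 hg)).of_eq fun n => by simp)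

protected theorem pair (hf : ComputableFrom f h) (hg : ComputableFrom g h) :
    ComputableFrom (fun n => Nat.pair (f n) (g n)) h :=
  iff_nat.2 (((iff_nat.1 hf).pair (iff_nat.1 hg)).of_eq fun n => by simp [Seq.seq])

protected theorem prec (hf : ComputableFrom f h) (hg : ComputableFrom g h) :
    ComputableFrom (fun p => (Nat.rec (f p.unpair.1)
      (fun y v => g (Nat.pair p.unpair.1 (Nat.pair y v))) p.unpair.2 : ℕ)) h :=
  iff_nat.2 (((iff_nat.1 hf).prec (iff_nat.1 hg)).of_eq fun p => by
    generalize p.unpair = q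
    obtain ⟨a, n⟩ := q
    dsimp only
    induction n with
    | zero => rfl
    | succ n ih => simp only [ih]; simp)

protected theorem rfind (hf : ComputableFrom f h) (r : ℕ → ℕ)
    (h0 : ∀ a, f (Nat.pair a (r a)) = 0) (h1 : ∀ a, ∀ k < r a, f (Nat.pair a k) ≠ 0) :
    ComputableFrom r h :=
  iff_nat.2 ((iff_nat.1 hf).rfind.of_eq_tot fun a => by
    exact Nat.mem_rfind.2 ⟨by simp [h0 a], fun {m} hm => by simp [h1 a m hm]⟩)

theorem comp_primrec (hf : ComputableFrom f h) (hg : Primrec g) :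
    ComputableFrom (fun n => f (g n)) h := hf.comp (of_primrec hg)

theorem primrec_comp (hf : Primrec f) (hg : ComputableFrom g h) :
    ComputableFrom (fun n => f (g n)) h := (of_primrec hf).comp hg

theorem congr_fun {f' : ℕ → ℕ} (hf : ComputableFrom f h) (he : ∀ n, f n = f' n) :
    ComputableFrom f' h := (funext he : f = f') ▸ hf

end ComputableFrom

/-! ### Computing with initial segments of a real. -/

theorem initSeg_succ (Z : ℕ → ℕ) (n : ℕ) : initSeg Z (n + 1) = initSeg Z n ++ [Z n] := by
  simp [initSeg, List.range_succ]

theorem take_initSeg (Z : ℕ → ℕ) {n m : ℕ} (h : n ≤ m) : (initSeg Z m).take n = initSeg Z n := by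
  rw [List.prefix_iff_eq_take.1 (initSeg_prefix Z h), length_initSeg]

theorem computableFrom_initSeg (Z : ℕ → ℕ) :
    ComputableFrom (fun n => Encodable.encode (initSeg Z n)) Z := by
  have hstep : ComputableFrom (fun p => Encodable.encode
      (Denumerable.ofNat (List ℕ) p.unpair.2.unpair.2 ++ [Z p.unpair.2.unpair.1])) Z := by
    have h₁ : Primrec fun q : ℕ => Encodable.encode
        (Denumerable.ofNat (List ℕ) q.unpair.1 ++ [q.unpair.2]) := by fun_prop
    have h₂ : ComputableFrom (fun p : ℕ => Z p.unpair.2.unpair.1) Z :=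
      (ComputableFrom.refl Z).comp_primrec (g := fun p => p.unpair.2.unpair.1) (by fun_prop)
    have h₃ : ComputableFrom (fun p : ℕ => p.unpair.2.unpair.2) Z :=
      .of_primrec (by fun_prop)
    refine (ComputableFrom.primrec_comp h₁ (h₃.pair h₂)).congr_fun fun p => ?_
    simp
  have h := (ComputableFrom.of_primrec (Primrec.const (Encodable.encode ([] : List ℕ)))).prec hstep
  have := h.comp_primrec (g := fun n => Nat.pair 0 n) (by fun_prop)
  refine this.congr_fun fun n => ?_
  simp only [Nat.unpair_pair]
  induction n with
  | zero => rfl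
  | succ n ih => simp only [ih, initSeg_succ, Denumerable.ofNat_encode]

theorem computableFrom_of_initSeg {G : ℕ → List ℕ → ℕ} {b : ℕ → ℕ}
    (hG : Primrec fun p : ℕ × List ℕ => G p.1 p.2) (hb : Primrec b) (Z : ℕ → ℕ) :
    ComputableFrom (fun x => G x (initSeg Z (b x))) Z := by
  have h₁ : Primrec fun q : ℕ => G q.unpair.1 (Denumerable.ofNat (List ℕ) q.unpair.2) :=
    hG.comp (f := fun p : ℕ × List ℕ => G p.1 p.2)
      (g := fun q : ℕ => (q.unpair.1, Denumerable.ofNat (List ℕ) q.unpair.2)) (by fun_prop)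
  have h₂ : ComputableFrom (fun x => x) Z := .of_primrec Primrec.id
  refine (ComputableFrom.primrec_comp h₁
    (h₂.pair ((computableFrom_initSeg Z).comp_primrec hb))).congr_fun fun x => ?_
  simp

/-! ### The `ω`-Jump Tree of a real is computable -/

/-- `x` is the code of `J^ω` of an initial segment of `σ`. -/
noncomputable def memB (σ : List ℕ) (x : ℕ) : Bool :=
  decide ((List.range (σ.length + 1)).findIdx
    (fun n => decide (Encodable.encode (Jomega (σ.take n)) = x)) < σ.length + 1)

/-- The decision procedure for the Kleene–Brouwer order. -/
def kbB (σ τ : List ℕ) : Bool :=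
  decide (σ.take τ.length = τ) ||
    decide ((List.range σ.length).findIdx (fun i => decide (i < τ.length) &&
      (decide (σ.take i = τ.take i) && decide (σ.getD i 0 < τ.getD i 0))) < σ.length)

theorem findIdx_range_lt {p : ℕ → Bool} {n : ℕ} :
    (List.range n).findIdx p < n ↔ ∃ i < n, p i = true := by
  have := List.findIdx_lt_length (p := p) (xs := List.range n)
  simpa using this

/-- The bound suffices because `J^ω(Z ↾ n)` with code `x` forces `n ≤ x + 1`, by
`length_le_encode_Jomega`. -/
theorem memB_iff {Z : ℕ → ℕ} {N x : ℕ} (hN : x + 1 ≤ N) : memB (initSeg Z N) x = true ↔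
    x ∈ (kbOrder (omegaJumpTree (realTree Z))).dom := by
  rw [memB, decide_eq_true_iff, findIdx_range_lt, length_initSeg]
  constructor
  · rintro ⟨n, hn, hx⟩
    rw [decide_eq_true_iff, take_initSeg Z (by omega)] at hx
    exact ⟨_, ⟨_, ⟨n, rfl⟩, rfl⟩, hx⟩
  · rintro ⟨_, ⟨_, ⟨n, rfl⟩, rfl⟩, rfl⟩
    have h := length_le_encode_Jomega (initSeg Z n)
    rw [length_initSeg] at h
    exact ⟨n, by omega, by rw [take_initSeg Z (by omega), decide_eq_true_iff]⟩

theorem kbB_iff {σ τ : List ℕ} : kbB σ τ = true ↔ KB σ τ := by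
  rw [kbB, Bool.or_eq_true, decide_eq_true_iff, decide_eq_true_iff, findIdx_range_lt, KB,
    List.prefix_iff_eq_take, eq_comm]
  refine or_congr Iff.rfl ⟨?_, ?_⟩
  · rintro ⟨i, hi, h⟩
    simp only [Bool.and_eq_true, decide_eq_true_iff] at h
    obtain ⟨h₁, h₂, h₃⟩ := h
    refine ⟨i, hi, h₁, h₂, ?_⟩
    simpa [List.getD, hi, h₁] using h₃
  · rintro ⟨i, hi, h₁, h₂, h₃⟩
    refine ⟨i, hi, ?_⟩
    simp [List.getD, hi, h₁, h₂, h₃]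

theorem kbOrder_le_iff {T : Set (List ℕ)} {x y : ℕ} : (kbOrder T).le x y ↔
    x ∈ (kbOrder T).dom ∧ y ∈ (kbOrder T).dom ∧
      KB (Denumerable.ofNat (List ℕ) x) (Denumerable.ofNat (List ℕ) y) := by
  constructor
  · rintro ⟨σ, hσ, τ, hτ, rfl, rfl, h⟩
    exact ⟨⟨σ, hσ, rfl⟩, ⟨τ, hτ, rfl⟩, by simpa using h⟩
  · rintro ⟨⟨σ, hσ, rfl⟩, ⟨τ, hτ, rfl⟩, h⟩
    exact ⟨σ, hσ, τ, hτ, rfl, rfl, by simpa using h⟩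

theorem ite_eq_charFn {S : Set ℕ} {b : Bool} {n : ℕ} (h : b = true ↔ n ∈ S) :
    (if b = true then 1 else 0) = charFn S n := by
  by_cases hn : n ∈ S <;> simp [charFn, h, hn]

theorem isComputableFrom_kbOrder (Z : ℕ → ℕ) :
    (kbOrder (omegaJumpTree (realTree Z))).IsComputableFrom Z := by
  constructor
  · have h : Primrec fun p : ℕ × List ℕ => if memB p.2 p.1 = true then 1 else 0 := by
      unfold memB; fun_prop
    refine (computableFrom_of_initSeg (G := fun x σ => if memB σ x = true then 1 else 0)
      (b := fun x => x + 1) h (by fun_prop) Z).congr_fun fun x => ?_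
    exact ite_eq_charFn (memB_iff le_rfl)
  · have h : Primrec fun p : ℕ × List ℕ =>
        if (memB p.2 p.1.unpair.1 && (memB p.2 p.1.unpair.2 &&
          kbB (Denumerable.ofNat (List ℕ) p.1.unpair.1) (Denumerable.ofNat (List ℕ) p.1.unpair.2)))
          = true then 1 else 0 := by
      unfold memB kbB; fun_prop
    refine (computableFrom_of_initSeg (G := fun p σ => if (memB σ p.unpair.1 &&
        (memB σ p.unpair.2 &&
          kbB (Denumerable.ofNat (List ℕ) p.unpair.1) (Denumerable.ofNat (List ℕ) p.unpair.2)))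
          = true then 1 else 0)
      (b := fun x => x + 1) h (by fun_prop) Z).congr_fun fun p => ?_
    have h₁ := Nat.unpair_left_le p
    have h₂ := Nat.unpair_right_le p
    refine ite_eq_charFn ?_
    rw [Bool.and_eq_true, Bool.and_eq_true, memB_iff (show p.unpair.1 + 1 ≤ p + 1 by omega),
      memB_iff (show p.unpair.2 + 1 ≤ p + 1 by omega), kbB_iff, ← kbOrder_le_iff]
    rfl

theorem computableFrom_code_descent (Z : ℕ → ℕ) :
    ComputableFrom (fun n => (descent [] (initSeg Z (n + 1))).code) Z :=
  computableFrom_of_initSeg (G := fun _ σ => (descent [] σ).code) (b := fun n => n + 1)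
    (primrec_code_descent.comp (f := fun p : List ℕ × List ℕ => (descent p.1 p.2).code)
      (g := fun p : ℕ × List ℕ => ([], p.2)) (by fun_prop)) (by fun_prop) Z

/-! ### Programs for the machine -/

/-- The code of `pair`. -/
def codePair (a b : ℕ) : ℕ := 4 * Nat.pair a b + 5

/-- The code of `comp`. -/
def codeComp (a b : ℕ) : ℕ := 4 * Nat.pair a b + 1 + 5

/-- The code of `prec`. -/
def codePrec (a b : ℕ) : ℕ := 4 * Nat.pair a b + 2 + 5

/-- The code of `rfind`. -/
def codeRfind (a : ℕ) : ℕ := 4 * a + 3 + 5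

/-- The code of a program for the constant function with value `n`. -/
def codeConst (n : ℕ) : ℕ := Nat.rec 0 (fun _ c => codeComp 1 c) n

theorem ofNat_codePair (a b : ℕ) :
    Prog.ofNat (codePair a b) = .pair (Prog.ofNat a) (Prog.ofNat b) := by
  have h₁ : 4 * Nat.pair a b % 4 = 0 := by omega
  have h₂ : 4 * Nat.pair a b / 4 = Nat.pair a b := by omega
  rw [codePair, Prog.ofNat_add_five, h₁, h₂, Nat.unpair_pair]
  rfl

theorem ofNat_codeComp (a b : ℕ) :
    Prog.ofNat (codeComp a b) = .comp (Prog.ofNat a) (Prog.ofNat b) := by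
  have h₁ : (4 * Nat.pair a b + 1) % 4 = 1 := by omega
  have h₂ : (4 * Nat.pair a b + 1) / 4 = Nat.pair a b := by omega
  rw [codeComp, Prog.ofNat_add_five, h₁, h₂, Nat.unpair_pair]
  rfl

theorem ofNat_codePrec (a b : ℕ) :
    Prog.ofNat (codePrec a b) = .prec (Prog.ofNat a) (Prog.ofNat b) := by
  have h₁ : (4 * Nat.pair a b + 2) % 4 = 2 := by omega
  have h₂ : (4 * Nat.pair a b + 2) / 4 = Nat.pair a b := by omega
  rw [codePrec, Prog.ofNat_add_five, h₁, h₂, Nat.unpair_pair]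
  rfl

theorem ofNat_codeRfind (a : ℕ) : Prog.ofNat (codeRfind a) = .rfind (Prog.ofNat a) := by
  have h₁ : (4 * a + 3) % 4 = 3 := by omega
  have h₂ : (4 * a + 3) / 4 = a := by omega
  rw [codeRfind, Prog.ofNat_add_five, h₁, h₂]
  rfl

@[fun_prop] theorem primrec_codeConst {α : Type*} [Primcodable α] {f : α → ℕ}
    (hf : Primrec f) : Primrec fun a => codeConst (f a) :=
  primrec_natRec hf (by fun_prop) (by unfold codeComp; fun_prop)

/-- The machine started in the state `s` reaches the state `t`. -/
def Reaches (o : ℕ → Option ℕ) (s t : State) : Prop := ∃ k, (step o)^[k] s = t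

theorem Reaches.trans {o : ℕ → Option ℕ} {s t u : State} (h : Reaches o s t)
    (h' : Reaches o t u) : Reaches o s u := by
  obtain ⟨k, rfl⟩ := h
  obtain ⟨l, rfl⟩ := h'
  exact ⟨l + k, Function.iterate_add_apply _ _ _ _⟩

theorem Reaches.head {o : ℕ → Option ℕ} {s u : State} (h : Reaches o (step o s) u) :
    Reaches o s u :=
  Reaches.trans ⟨1, rfl⟩ h

theorem Reaches.refl (o : ℕ → Option ℕ) (s : State) : Reaches o s s := ⟨0, rfl⟩

theorem Reaches.halts_iff {o : ℕ → Option ℕ} {s t : State} (h : Reaches o s t) :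
    (∃ v, Reaches o s (.ret v [])) ↔ ∃ v, Reaches o t (.ret v []) := by
  obtain ⟨k, rfl⟩ := h
  refine ⟨fun ⟨v, l, hl⟩ => ⟨v, l, ?_⟩, fun ⟨v, h⟩ => ⟨v, Reaches.trans ⟨k, rfl⟩ h⟩⟩
  rw [← Function.iterate_add_apply, add_comm, Function.iterate_add_apply, hl, step_ret_nil]

/-- The `e`-th program with oracle `o` computes the function `φ`. -/
def Computes (o : ℕ → Option ℕ) (e : ℕ) (φ : ℕ → ℕ) : Prop :=
  ∀ n K, Reaches o (.run (Prog.ofNat e) n K) (.ret (φ n) K)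

namespace Computes

variable {o : ℕ → Option ℕ} {a b : ℕ} {φ ψ : ℕ → ℕ}

protected theorem zero : Computes o 0 fun _ => 0 := fun _ _ => ⟨1, by simp [Prog.ofNat, step]⟩

protected theorem succ : Computes o 1 fun n => n + 1 := fun _ _ => ⟨1, by simp [Prog.ofNat, step]⟩

protected theorem left : Computes o 2 fun n => n.unpair.1 :=
  fun _ _ => ⟨1, by simp [Prog.ofNat, step]⟩

protected theorem right : Computes o 3 fun n => n.unpair.2 :=
  fun _ _ => ⟨1, by simp [Prog.ofNat, step]⟩

protected theorem oracle (Z : ℕ → ℕ) : Computes (fun i => some (Z i)) 4 Z :=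
  fun _ _ => ⟨1, by simp [Prog.ofNat, step]⟩

protected theorem pair (ha : Computes o a φ) (hb : Computes o b ψ) :
    Computes o (codePair a b) fun n => Nat.pair (φ n) (ψ n) := by
  intro n K
  rw [ofNat_codePair]
  exact .head ((ha n _).trans (.head ((hb n _).trans (.head (.refl _ _)))))

protected theorem comp (ha : Computes o a φ) (hb : Computes o b ψ) :
    Computes o (codeComp a b) fun n => φ (ψ n) := by
  intro n K
  rw [ofNat_codeComp]
  exact .head ((hb n _).trans (.head (ha _ _)))

protected theorem prec (ha : Computes o a φ) (hb : Computes o b ψ) :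
    Computes o (codePrec a b) fun p => (Nat.rec (φ p.unpair.1)
      (fun y v => ψ (Nat.pair p.unpair.1 (Nat.pair y v))) p.unpair.2 : ℕ) := by
  intro p K
  rw [ofNat_codePrec]
  generalize hx : p.unpair.1 = x
  generalize hm : p.unpair.2 = m
  have key : ∀ k ≤ m, Reaches o (.run (.prec (Prog.ofNat a) (Prog.ofNat b)) p K)
      (.ret (Nat.rec (φ x) (fun y v => ψ (Nat.pair x (Nat.pair y v))) k)
        (.prec (Prog.ofNat b) x k m :: K)) := by
    intro k
    induction k with
    | zero =>
      intro _
      refine .head ?_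
      rw [step, hx, hm]
      exact ha _ _
    | succ k ih =>
      intro hk
      refine (ih (by omega)).trans (.head ?_)
      rw [step, if_pos (by omega)]
      exact hb _ _
  refine (key m le_rfl).trans (.head ?_)
  rw [step, if_neg (lt_irrefl m)]
  subst hx hm
  exact .refl _ _

protected theorem const (n : ℕ) : Computes o (codeConst n) fun _ => n := by
  induction n with
  | zero => exact Computes.zero
  | succ n ih => exact Computes.succ.comp ih

theorem exists_of_primrec {f : ℕ → ℕ} (hf : Primrec f) : ∃ e, ∀ o, Computes o e f := by
  rw [Primrec.nat_iff] at hf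
  induction hf with
  | zero => exact ⟨0, fun _ => Computes.zero⟩
  | succ => exact ⟨1, fun _ => Computes.succ⟩
  | left => exact ⟨2, fun _ => Computes.left⟩
  | right => exact ⟨3, fun _ => Computes.right⟩
  | pair _ _ ihf ihg =>
    obtain ⟨a, ha⟩ := ihf
    obtain ⟨b, hb⟩ := ihg
    exact ⟨_, fun o => (ha o).pair (hb o)⟩
  | comp _ _ ihf ihg =>
    obtain ⟨a, ha⟩ := ihf
    obtain ⟨b, hb⟩ := ihg
    exact ⟨_, fun o => (ha o).comp (hb o)⟩
  | prec _ _ ihf ihg =>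
    obtain ⟨a, ha⟩ := ihf
    obtain ⟨b, hb⟩ := ihg
    exact ⟨_, fun o => (ha o).prec (hb o)⟩

/-- Without a zero the machine is still running at arbitrarily late times, which is impossible once
it has halted. -/
theorem halts_rfind_iff (hb : Computes o b ψ) (x : ℕ) :
    (∃ v, Reaches o (.run (Prog.ofNat (codeRfind b)) x []) (.ret v [])) ↔
      ∃ k, ψ (Nat.pair x k) = 0 := by
  rw [ofNat_codeRfind]
  have key : ∀ k, (∀ j < k, ψ (Nat.pair x j) ≠ 0) → ∃ s ≥ k,
      (step o)^[s] (.run (.rfind (Prog.ofNat b)) x []) =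
        .run (Prog.ofNat b) (Nat.pair x k) [.rfind (Prog.ofNat b) x k] := by
    intro k
    induction k with
    | zero => exact fun _ => ⟨1, by omega, rfl⟩
    | succ k ih =>
      intro hk
      obtain ⟨s, hs, he⟩ := ih fun j hj => hk j (by omega)
      obtain ⟨t, ht⟩ := hb (Nat.pair x k) [.rfind (Prog.ofNat b) x k]
      refine ⟨1 + (t + s), by omega, ?_⟩
      rw [Function.iterate_add_apply, Function.iterate_add_apply, he, ht, Function.iterate_one,
        step, if_neg (hk k (by omega))]
  constructor
  · rintro ⟨v, s, hs⟩
    by_contra! h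
    obtain ⟨t, ht, he⟩ := key s fun j _ => h j
    obtain ⟨d, rfl⟩ := Nat.exists_eq_add_of_le' ht
    rw [Function.iterate_add_apply, hs, step_ret_nil] at he
    cases he
  · intro h
    obtain ⟨s, -, he⟩ := key (Nat.find h) fun j hj => Nat.find_min h hj
    refine ⟨Nat.find h, Reaches.trans ⟨s, he⟩ ((hb _ _).trans (.head ?_))⟩
    rw [step, if_pos (Nat.find_spec h)]
    exact .refl _ _

end Computes

/-- `r` is a program for a predicate of numbers and strings, which holds where the value is `0`.
The program searches for an initial segment of the function computed by the `p`-th program which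
satisfies the predicate together with `x`; here `s` is a program which appends a number to a
string. -/
def codeSearch (s r p x : ℕ) : ℕ :=
  codeComp (codeRfind (codeComp r (codePair 2
    (codePrec 0 (codeComp s (codePair (codeComp 3 3) (codeComp p (codeComp 2 3))))))))
    (codeConst x)

@[fun_prop] theorem primrec_codeSearch {α : Type*} [Primcodable α] (s r : ℕ) {f g : α → ℕ}
    (hf : Primrec f) (hg : Primrec g) : Primrec fun a => codeSearch s r (f a) (g a) := by
  unfold codeSearch codeComp codeRfind codePair codePrec
  fun_prop

theorem exists_codeSearch (R : ℕ → List ℕ → Bool)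
    (hR : Primrec fun p : ℕ × List ℕ => R p.1 p.2) :
    ∃ s r, ∀ (Y φ : ℕ → ℕ) (p x n : ℕ), Computes (fun i => some (Y i)) p φ →
      (HaltsReal Y (codeSearch s r p x) n ↔ ∃ N, R x (initSeg φ N) = true) := by
  have h₁ : Primrec fun q : ℕ => Encodable.encode
      (Denumerable.ofNat (List ℕ) q.unpair.1 ++ [q.unpair.2]) := by fun_prop
  have h₂ : Primrec fun q : ℕ =>
      if R q.unpair.1 (Denumerable.ofNat (List ℕ) q.unpair.2) = true then 0 else 1 := by
    have := hR.comp (f := fun p : ℕ × List ℕ => R p.1 p.2)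
      (g := fun q : ℕ => (q.unpair.1, Denumerable.ofNat (List ℕ) q.unpair.2)) (by fun_prop)
    fun_prop
  obtain ⟨s, hs⟩ := Computes.exists_of_primrec h₁
  obtain ⟨r, hr⟩ := Computes.exists_of_primrec h₂
  refine ⟨s, r, fun Y φ p x n hp => ?_⟩
  set o : ℕ → Option ℕ := fun i => some (Y i)
  -- On `(x, N)` the recursion starts from `0`, the code of the empty string, and appends `φ y` for
  -- each `y < N`; `r` then tests `x` against `φ ↾ N`.
  have hbody := (hr o).comp (Computes.left.pair (Computes.zero.prec ((hs o).comp
    ((Computes.right.comp Computes.right).pair (hp.comp (Computes.left.comp Computes.right))))))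
  have hseg : ∀ k : ℕ, (Nat.rec 0 (fun y v => Encodable.encode
      (Denumerable.ofNat (List ℕ) v ++ [φ y])) k : ℕ) = Encodable.encode (initSeg φ k) := by
    intro k
    induction k with
    | zero => rfl
    | succ k ih => simp only [ih, initSeg_succ, Denumerable.ofNat_encode]
  have hreach : Reaches o (.run (Prog.ofNat (codeSearch s r p x)) n [])
      (.run (Prog.ofNat (codeRfind (codeComp r (codePair 2 (codePrec 0 (codeComp s
        (codePair (codeComp 3 3) (codeComp p (codeComp 2 3)))))))) ) x []) := by
    rw [codeSearch, ofNat_codeComp]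
    exact .head ((Computes.const x _ _).trans (.head (.refl _ _)))
  have : HaltsReal Y (codeSearch s r p x) n ↔
      ∃ v, Reaches o (.run (Prog.ofNat (codeSearch s r p x)) n []) (.ret v []) :=
    ⟨fun ⟨k, v, h⟩ => ⟨v, k, h⟩, fun ⟨v, k, h⟩ => ⟨k, v, h⟩⟩
  rw [this, hreach.halts_iff, hbody.halts_rfind_iff]
  simp only [Nat.unpair_pair, hseg, Denumerable.ofNat_encode]
  simp

/-! ### Iterated jumps from a sequence of true stages -/

/-- Codes of programs which compute `Z^(m)` from `L m`, given programs `h` and `q` which evaluate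
`(w, e) ↦ {e}^w(e)↓` and `(p, x) ↦ codeSearch s r p x`. -/
def codeJump (h q m : ℕ) : ℕ :=
  Nat.rec 4 (fun _ c => codeComp h (codePair (codeComp 4 (codeComp q (codePair (codeConst c)
    (codePair 2 3)))) (codeComp q (codePair (codeConst c) (codePair 2 3))))) m

@[fun_prop] theorem primrec_codeJump {α : Type*} [Primcodable α] (h q : ℕ) {f : α → ℕ}
    (hf : Primrec f) : Primrec fun a => codeJump h q (f a) :=
  primrec_natRec hf (by fun_prop) (by unfold codeComp codePair; fun_prop)

/-- If program `p` computes `φ` from `L m`, then `{x}^φ(x)↓` becomes the halting of a search program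
with oracle `L m`. That program ignores its input, so it may be run on its own index `e`, and the
string coded by `L (m + 1) e` decides it. Iterating yields programs computing `Z^(m)` from `L m`,
with indices primitive recursive in `m`. -/
theorem computableFrom_omegaTuringJump {L : ℕ → ℕ → ℕ}
    (hL : ∀ m e, HaltsReal (L m) e e ↔
      HaltsString (Denumerable.ofNat (List ℕ) (L (m + 1) e)) e e) :
    ComputableFrom (omegaTuringJump (L 0)) fun n => L n.unpair.1 n.unpair.2 := by
  obtain ⟨s, r, hsr⟩ := exists_codeSearch (fun x σ => haltsB σ x x) (by fun_prop)
  obtain ⟨h, hh⟩ := Computes.exists_of_primrec (f := fun w =>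
    if haltsB (Denumerable.ofNat (List ℕ) w.unpair.1) w.unpair.2 w.unpair.2 = true then 1 else 0)
    (by fun_prop)
  obtain ⟨q, hq⟩ := Computes.exists_of_primrec (f := fun w =>
    codeSearch s r w.unpair.1 w.unpair.2) (by fun_prop)
  have hjump : ∀ (m p x : ℕ) (φ : ℕ → ℕ), Computes (fun i => some (L m i)) p φ →
      (if haltsB (Denumerable.ofNat (List ℕ) (L (m + 1) (codeSearch s r p x)))
        (codeSearch s r p x) (codeSearch s r p x) = true then 1 else 0) = turingJump φ x := by
    intro m p x φ hp
    refine ite_eq_charFn ?_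
    rw [haltsB_iff, ← hL, hsr _ φ p x _ hp]
    simp only [haltsB_iff]
    exact haltsReal_iff.symm
  have hcode : ∀ m, Computes (fun i => some (L m i)) (codeJump h q m) (turingJump^[m] (L 0)) := by
    intro m
    induction m with
    | zero => exact Computes.oracle (L 0)
    | succ m ih =>
      have hid := (hq fun i => some (L (m + 1) i)).comp
        ((Computes.const (codeJump h q m)).pair (Computes.left.pair Computes.right))
      have := (hh _).comp (((Computes.oracle (L (m + 1))).comp hid).pair hid)
      rw [Function.iterate_succ_apply']
      intro x K
      rw [← hjump m _ x _ ih]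
      have h' := this x K
      simp only [Nat.unpair_pair, Nat.pair_unpair] at h'
      exact h'
  -- One query to the join suffices: row `0` is read directly, and row `m + 1` is read at the index
  -- of the search program for row `m`.
  have h₁ : Primrec fun n : ℕ => if n.unpair.1 = 0 then n else
      Nat.pair n.unpair.1 (codeSearch s r (codeJump h q (n.unpair.1 - 1)) n.unpair.2) := by
    fun_prop
  have h₂ : Primrec fun w : ℕ => if w.unpair.1.unpair.1 = 0 then w.unpair.2 else
      if haltsB (Denumerable.ofNat (List ℕ) w.unpair.2) w.unpair.1.unpair.2 w.unpair.1.unpair.2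
        = true then 1 else 0 := by
    fun_prop
  refine (ComputableFrom.primrec_comp h₂ ((ComputableFrom.of_primrec h₁).pair
    ((ComputableFrom.refl _).comp_primrec h₁))).congr_fun fun n => ?_
  simp only [Nat.unpair_pair, omegaTuringJump]
  rcases hm : n.unpair.1 with _ | m
  · simp [hm]
  · simp only [Nat.add_eq_zero_iff, one_ne_zero, and_false, if_false, Nat.unpair_pair,
      Nat.add_sub_cancel]
    rw [Function.iterate_succ_apply']
    exact hjump m _ _ _ (hcode m)

/-! ### Descending sequences in the Kleene–Brouwer order -/

/-- The empty string is the greatest, so all later strings are nonempty; their first entries are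
nonincreasing and eventually reach the minimum. -/
theorem exists_eventually_head {η : ℕ → List ℕ} (h : ∀ n, KB (η (n + 1)) (η n) ∧ η (n + 1) ≠ η n) :
    ∃ a N, ∀ n ≥ N, ∃ θ, η n = a :: θ := by
  have hne : ∀ n, η (n + 1) ≠ [] := by
    intro n h0
    obtain ⟨h₁, h₂⟩ := h n
    rw [h0] at h₁ h₂
    rcases hn : η n with _ | ⟨b, τ⟩
    · exact h₂ hn.symm
    · rw [hn] at h₁
      exact KB_nil_cons b τ h₁
  have hanti : Antitone fun n => (η (n + 1)).headD 0 := by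
    refine antitone_nat_of_succ_le fun n => ?_
    obtain ⟨b, τ, hb⟩ := List.exists_cons_of_ne_nil (hne n)
    obtain ⟨a, σ, ha⟩ := List.exists_cons_of_ne_nil (hne (n + 1))
    have := (h (n + 1)).1
    rw [ha, hb, KB_cons_cons] at this
    rw [ha, hb]
    simp only [List.headD_cons]
    omega
  have hex : ∃ a n, (η (n + 1)).headD 0 = a := ⟨_, 0, rfl⟩
  classical
  obtain ⟨N, hN⟩ := Nat.find_spec hex
  refine ⟨Nat.find hex, N + 1, fun n hn => ?_⟩
  obtain ⟨m, rfl⟩ : ∃ m, n = m + 1 := ⟨n - 1, by omega⟩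
  obtain ⟨a, σ, ha⟩ := List.exists_cons_of_ne_nil (hne m)
  have h₁ : (η (m + 1)).headD 0 ≤ (η (N + 1)).headD 0 := hanti (by omega)
  have h₂ : Nat.find hex ≤ (η (m + 1)).headD 0 := Nat.find_min' hex ⟨m, rfl⟩
  rw [ha] at h₁ h₂
  rw [List.headD_cons] at h₁ h₂
  exact ⟨σ, by rw [ha, show a = Nat.find hex by omega]⟩

/-- Once the first entry is constant, the tails again form a descending sequence. -/
theorem exists_eventually_getElem? {η : ℕ → List ℕ}
    (h : ∀ n, KB (η (n + 1)) (η n) ∧ η (n + 1) ≠ η n) (j : ℕ) :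
    ∃ v N, ∀ n ≥ N, (η n)[j]? = some v := by
  induction j generalizing η with
  | zero =>
    obtain ⟨a, N, hN⟩ := exists_eventually_head h
    refine ⟨a, N, fun n hn => ?_⟩
    obtain ⟨θ, hθ⟩ := hN n hn
    simp [hθ]
  | succ j ih =>
    obtain ⟨a, N, hN⟩ := exists_eventually_head h
    have htail : ∀ n, η (N + n) = a :: (η (N + n)).tail := by
      intro n
      obtain ⟨θ, hθ⟩ := hN (N + n) (by omega)
      rw [hθ, List.tail_cons]
    obtain ⟨v, M, hM⟩ := ih (η := fun n => (η (N + n)).tail) fun n => by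
      obtain ⟨h₁, h₂⟩ := h (N + n)
      have e₁ := htail n
      have e₂ : η (N + n + 1) = a :: (η (N + (n + 1))).tail := htail (n + 1)
      refine ⟨?_, fun he => h₂ ?_⟩
      · rw [e₁, e₂, KB_cons_cons] at h₁
        simpa using h₁
      · rw [e₁, e₂, he]
    refine ⟨v, N + M, fun n hn => ?_⟩
    have h₁ := hM (n - N) (by omega)
    have h₂ := htail (n - N)
    rw [show N + (n - N) = n by omega] at h₁ h₂
    rw [h₂, List.getElem?_cons_succ]
    exact h₁

theorem getElem?_eq_some_iff_getD {l : List ℕ} {j v : ℕ} :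
    l[j]? = some v ↔ j < l.length ∧ l.getD j 0 = v := by
  by_cases h : j < l.length
  · simp [List.getD, h]
  · simp [h]

/-- The limit of a pointwise convergent sequence of strings is computable from the jump. -/
theorem exists_limit_computableFrom {f : ℕ → ℕ}
    (h : ∀ j : ℕ, ∃ v N : ℕ, ∀ n ≥ N, (Denumerable.ofNat (List ℕ) (f n))[j]? = some v) :
    ∃ Y : ℕ → ℕ, ComputableFrom Y (turingJump f) ∧
      ∀ j : ℕ, ∃ N : ℕ, ∀ n ≥ N, (Denumerable.ofNat (List ℕ) (f n))[j]? = some (Y j) := by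
  -- For `x = (j, (N, v))` the search looks for a counterexample to the guess that entry `j` is `v`
  -- from index `N` on; the last entry of `f ↾ (n + 1)` is `f n`. The jump decides whether one
  -- exists, and the least correct guess yields the limit.
  obtain ⟨s, r, hsr⟩ := exists_codeSearch (fun x σ =>
    decide (x.unpair.2.unpair.1 < σ.length) &&
      !(decide (x.unpair.1 <
          (Denumerable.ofNat (List ℕ) (σ.getD (σ.length - 1) 0)).length) &&
        decide ((Denumerable.ofNat (List ℕ) (σ.getD (σ.length - 1) 0)).getD x.unpair.1 0 =
          x.unpair.2.unpair.2))) (by fun_prop)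
  have hquery : ∀ j x, turingJump f (codeSearch s r 4 (Nat.pair j x)) = 0 ↔
      ∀ n ≥ x.unpair.1, (Denumerable.ofNat (List ℕ) (f n))[j]? = some x.unpair.2 := by
    intro j x
    have h₁ : turingJump f (codeSearch s r 4 (Nat.pair j x)) = 0 ↔
        ¬ HaltsReal f (codeSearch s r 4 (Nat.pair j x)) (codeSearch s r 4 (Nat.pair j x)) := by
      simp [turingJump, charFn]
    rw [h₁, hsr f f 4 _ _ (Computes.oracle f), not_exists]
    simp only [Nat.unpair_pair, length_initSeg, Bool.and_eq_true, decide_eq_true_iff,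
      Bool.not_eq_true', Bool.and_eq_false_iff, decide_eq_false_iff_not, not_and, not_or, not_not]
    simp only [getElem?_eq_some_iff_getD]
    constructor
    · intro hx n hn
      have := hx (n + 1) (by omega)
      simpa [getElem?_initSeg, List.getD] using this
    · intro hx N hN
      obtain ⟨n, rfl⟩ : ∃ n, N = n + 1 := ⟨N - 1, by omega⟩
      have := hx n (by omega)
      simpa [getElem?_initSeg, List.getD] using this
  have hex : ∀ j, ∃ x, turingJump f (codeSearch s r 4 (Nat.pair j x)) = 0 := by
    intro j
    obtain ⟨v, N, hN⟩ := h j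
    exact ⟨Nat.pair N v, by rw [hquery]; simpa using hN⟩
  have hF : ComputableFrom (fun w => turingJump f
      (codeSearch s r 4 w)) (turingJump f) :=
    (ComputableFrom.refl _).comp_primrec (by fun_prop)
  have hfind := hF.rfind (fun j => Nat.find (hex j)) (fun j => Nat.find_spec (hex j))
    fun j k hk => Nat.find_min (hex j) hk
  refine ⟨fun j => (Nat.find (hex j)).unpair.2,
    ComputableFrom.primrec_comp (f := fun x => x.unpair.2) (by fun_prop) hfind, fun j => ?_⟩
  exact ⟨_, (hquery j _).1 (Nat.find_spec (hex j))⟩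

/-! ### True stages from the limit of a descending sequence -/

/-- The string coded by the last entry of `α`. -/
def decodeLast (α : List ℕ) : List ℕ := Denumerable.ofNat (List ℕ) (α.getD (α.length - 1) 0)

/-- The last entry of `α` codes `ρ ↾ t_{|α|-1}`, and `t_n ≥ n + 2`. Each decoding thus undoes one
Jump and gains length. -/
theorem decodeLast_prefix {α ρ : List ℕ} (hα : α ≠ []) (h : α <+: J ρ) :
    decodeLast α <+: ρ ∧ α.length + 1 ≤ (decodeLast α).length := by
  have hpos := List.length_pos_iff.2 hα
  have hlast : α.length - 1 < (J ρ).length := by have := h.length_le; omega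
  have hget : α.getD (α.length - 1) 0 = (J ρ)[α.length - 1] := by
    obtain ⟨β, hβ⟩ := h
    have h₁ : α.length - 1 < α.length := by omega
    simp only [← hβ, List.getElem_append_left h₁, List.getD, List.getElem?_eq_getElem h₁,
      Option.getD_some]
  have hle := lt_length_J.1 hlast
  have hge := succ_le_stage ρ (α.length - 1 + 1)
  rw [decodeLast, hget, getElem_J, Denumerable.ofNat_encode]
  refine ⟨List.take_prefix _ _, ?_⟩
  rw [List.length_take]
  omega

theorem iterate_decodeLast_prefix {ρ : List ℕ} {d : ℕ} : ∀ {α : List ℕ}, α ≠ [] →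
    α <+: J^[d] ρ →
    decodeLast^[d] α <+: ρ ∧ α.length + d ≤ (decodeLast^[d] α).length := by
  induction d with
  | zero => exact fun _ h => ⟨h, le_rfl⟩
  | succ d ih =>
    intro α hα h
    rw [Function.iterate_succ_apply'] at h
    obtain ⟨h₁, h₂⟩ := decodeLast_prefix hα h
    obtain ⟨h₃, h₄⟩ := ih (by rw [← List.length_pos_iff]; omega) h₁
    exact ⟨h₃, by rw [Function.iterate_succ_apply]; omega⟩

/-- The limits of the iterated Jumps of strings `σ_i`, where `Y` is the limit of `J^ω(σ_i)`. -/
def limitJump (Y : ℕ → ℕ) (m j : ℕ) : ℕ := (decodeLast^[j + 1] [Y (m + j)]).getD j 0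

theorem computableFrom_limitJump (Y : ℕ → ℕ) :
    ComputableFrom (fun n => limitJump Y n.unpair.1 n.unpair.2) Y := by
  have h₁ : Primrec fun w : ℕ =>
      (decodeLast^[w.unpair.1 + 1] [w.unpair.2]).getD w.unpair.1 0 :=
    primrec_getD (primrec_iterate (by fun_prop) (by fun_prop) (by unfold decodeLast; fun_prop))
      (by fun_prop)
  have h₂ : Primrec fun n : ℕ => n.unpair.2 := by fun_prop
  refine (ComputableFrom.primrec_comp h₁ ((ComputableFrom.of_primrec h₂).pair
    ((ComputableFrom.refl Y).comp_primrec (g := fun n => n.unpair.1 + n.unpair.2)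
      (by fun_prop)))).congr_fun fun n => ?_
  simp [limitJump]

/-- Eventually `Y (m + j)` is the first entry of `J^{m+j+1}(σ_i)`. Decoding it `j + 1` times leaves
an initial segment of `J^m(σ_i)` of length at least `j + 2`. -/
theorem getElem?_iterate_J_eventually {Y : ℕ → ℕ} {σ : ℕ → List ℕ}
    (hY : ∀ j : ℕ, ∃ N : ℕ, ∀ i ≥ N, (Jomega (σ i))[j]? = some (Y j)) (m j : ℕ) :
    ∃ N, ∀ i ≥ N, (J^[m] (σ i))[j]? = some (limitJump Y m j) := by
  obtain ⟨N, hN⟩ := hY (m + j)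
  refine ⟨N, fun i hi => ?_⟩
  have hhead := getElem?_Jomega (hN i hi)
  have hpre : [Y (m + j)] <+: J^[j + 1] (J^[m] (σ i)) := by
    rw [← Function.iterate_add_apply, show j + 1 + m = m + j + 1 by omega]
    obtain ⟨τ, hτ⟩ := List.head?_eq_some_iff.1 hhead
    exact ⟨τ, hτ.symm⟩
  obtain ⟨⟨τ, h₁⟩, h₂⟩ := iterate_decodeLast_prefix (by simp) hpre
  simp only [List.length_singleton] at h₂
  have h₃ : j < (decodeLast^[j + 1] [Y (m + j)]).length := by omega
  rw [← h₁, List.getElem?_append_left h₃, getElem?_eq_some_iff_getD]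
  exact ⟨h₃, rfl⟩

theorem initSeg_limitJump_eventually {Y : ℕ → ℕ} {σ : ℕ → List ℕ}
    (hY : ∀ j : ℕ, ∃ N : ℕ, ∀ i ≥ N, (Jomega (σ i))[j]? = some (Y j)) (m n : ℕ) :
    ∃ N, ∀ i ≥ N, initSeg (limitJump Y m) n <+: J^[m] (σ i) := by
  induction n with
  | zero => exact ⟨0, fun _ _ => List.nil_prefix⟩
  | succ n ih =>
    obtain ⟨N, hN⟩ := ih
    obtain ⟨M, hM⟩ := getElem?_iterate_J_eventually hY m n
    refine ⟨max N M, fun i hi => ?_⟩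
    obtain ⟨τ, hτ⟩ := hN i (le_of_max_le_left hi)
    have h := hM i (le_of_max_le_right hi)
    rw [← hτ, List.getElem?_append_right (by rw [length_initSeg]), length_initSeg,
      Nat.sub_self] at h
    rcases τ with _ | ⟨x, τ⟩
    · simp at h
    · have hx : x = limitJump Y m n := by simpa using h
      exact ⟨τ, by rw [initSeg_succ, ← hτ, hx]; simp⟩

/-- The limit entry `w` is eventually `J^m(σ_i) ↾ t_e`, and `t_e` is at least the halting time of
`e`. Since `w` and the initial segments of the limit are eventually initial segments of the same
string, convergence passes both ways. -/
theorem haltsReal_limitJump_iff {Y : ℕ → ℕ} {σ : ℕ → List ℕ}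
    (hY : ∀ j : ℕ, ∃ N : ℕ, ∀ i ≥ N, (Jomega (σ i))[j]? = some (Y j)) (m e : ℕ) :
    HaltsReal (limitJump Y m) e e ↔
    HaltsString (Denumerable.ofNat (List ℕ) (limitJump Y (m + 1) e)) e e := by
  set w := Denumerable.ofNat (List ℕ) (limitJump Y (m + 1) e) with hw
  have hstage : ∃ N, ∀ i ≥ N, w = (J^[m] (σ i)).take (stage (J^[m] (σ i)) (e + 1)) := by
    obtain ⟨N, hN⟩ := getElem?_iterate_J_eventually hY (m + 1) e
    refine ⟨N, fun i hi => ?_⟩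
    have h := hN i hi
    rw [Function.iterate_succ_apply'] at h
    obtain ⟨he, h⟩ := List.getElem?_eq_some_iff.1 h
    rw [getElem_J] at h
    rw [hw, ← h, Denumerable.ofNat_encode]
  obtain ⟨N, hN⟩ := hstage
  constructor
  · intro h
    obtain ⟨n, hn⟩ := haltsReal_iff.1 h
    obtain ⟨M, hM⟩ := initSeg_limitJump_eventually hY m n
    have h₁ := hn.mono (hM _ (le_max_right N M))
    rw [hN _ (le_max_left N M)]
    exact (haltTime_spec h₁).mono (List.take_prefix_take_left (by
      rw [stage_succ]; exact le_max_right _ _))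
  · intro h
    obtain ⟨M, hM⟩ := initSeg_limitJump_eventually hY m w.length
    have h₁ : w <+: J^[m] (σ (max N M)) := by
      conv_lhs => rw [hN _ (le_max_left N M)]
      exact List.take_prefix _ _
    have h₂ := hM _ (le_max_right N M)
    have h₃ : w <+: initSeg (limitJump Y m) w.length :=
      List.prefix_of_prefix_length_le h₁ h₂ (by rw [length_initSeg])
    exact (h.mono h₃).haltsReal

theorem omegaTuringJump_computableFrom {Z f : ℕ → ℕ}
    (hf : (kbOrder (omegaJumpTree (realTree Z))).IsDescending f) :
    ComputableFrom (omegaTuringJump Z) (turingJump f) := by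
  have hσ : ∀ n, ∃ k, Encodable.encode (Jomega (initSeg Z k)) = f n := by
    intro n
    obtain ⟨_, ⟨_, ⟨k, rfl⟩, rfl⟩, hk⟩ := hf.1 n
    exact ⟨k, hk⟩
  choose k hk using hσ
  have hof : ∀ n, Denumerable.ofNat (List ℕ) (f n) = Jomega (initSeg Z (k n)) := fun n => by
    rw [← hk, Denumerable.ofNat_encode]
  obtain ⟨Y, hYf, hY⟩ := exists_limit_computableFrom (f := f)
    (exists_eventually_getElem? fun n => by
      obtain ⟨h₁, h₂⟩ := hf.2 n
      refine ⟨(kbOrder_le_iff.1 h₁).2.2, fun he => h₂ ?_⟩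
      have := congrArg Encodable.encode he
      simpa using this)
  simp only [hof] at hY
  -- For `m = 0` the strings are initial segments of `Z`, and any defined entry of one is the value
  -- of `Z` there.
  have hZ : limitJump Y 0 = Z := by
    funext j
    obtain ⟨N, hN⟩ := getElem?_iterate_J_eventually hY 0 j
    have h := hN N le_rfl
    rw [Function.iterate_zero, id, getElem?_initSeg] at h
    split_ifs at h
    simpa using h.symm
  have h₁ := computableFrom_omegaTuringJump (haltsReal_limitJump_iff hY)
  rw [hZ] at h₁
  exact TuringReducible.trans h₁ (TuringReducible.trans (computableFrom_limitJump Y) hYf)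

end EpsJump

theorem mainTheorem4 (Z : ℕ → ℕ) :
    ∃ X : EpsJump.LinOrd,
      X = EpsJump.kbOrder (EpsJump.omegaJumpTree (EpsJump.realTree Z)) ∧
      X.IsComputableFrom Z ∧
      (∀ f : ℕ → ℕ, X.IsDescending f →
        EpsJump.ComputableFrom (EpsJump.omegaTuringJump Z) (EpsJump.turingJump f)) ∧
      ∃ a : ℕ → EpsJump.Term,
        EpsJump.ComputableFrom (fun n => (a n).code) Z ∧ EpsJump.Term.IsDescending X a :=
  ⟨_, rfl, EpsJump.isComputableFrom_kbOrder Z,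
    fun _ hf => EpsJump.omegaTuringJump_computableFrom hf, _,
    EpsJump.computableFrom_code_descent Z, EpsJump.isDescending_descent Z⟩
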